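/- Let $d\ge 1$ and let $\Omega\subset\mathbb R^d$ be a bounded open set with Lipschitz boundary (locally, in a suitable orthonormal frame, $\Omega$ is the region strictly above the graph of a Lipschitz function). For a field $\mathbf v:\Omega\to\mathbb R^d$ put $\mathcal D\mathbf v(\mathbf y,\mathbf x)=\dfrac{\mathbf v(\mathbf y)-\mathbf v(\mathbf x)}{|\mathbf y-\mathbf x|}$, and let $\mathbf i(\mathbf x)=\mathbf x$. Let $w:\mathbb R^d\times[-1,\infty)\to[0,\infty)$ satisfy the following conditions, where $0<\delta_0\le 1$ and arguments $s$ of $\Psi$ range over $[-1,\infty)$. i) $w(\boldsymbol\xi,s)=k(\boldsymbol\xi)\Psi(\boldsymbol\xi,s)$, where $\Psi$ is a Carathéodory function (measurable in $\boldsymbol\xi$, continuous in $s$) and $\Psi(\boldsymbol\xi,\cdot)$ is locally Lipschitz on $[-1,\infty)$ for each $\boldsymbol\xi$. ii) For each $\boldsymbol\xi$, $\Psi(\boldsymbol\xi,\cdot)$ is twice differentiable on $(-\delta_0,\delta_0)$ and belongs to $C^2([0,\delta_0])$, with $\Psi(\boldsymbol\xi,0)=0$, $\frac{\partial\Psi}{\partial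 s}(\boldsymbol\xi,0)=0$, $\frac{\partial^2\Psi}{\partial s^2}(\boldsymbol\xi,0)>0$; moreover $\inf_{|s|\ge s_0}\inf_{\boldsymbol\xi\in\mathbb R^d}\Psi(\boldsymbol\xi,s)>0$ for all $s_0>0$. iii) There is $c_1>0$ such that $k(\boldsymbol\xi)\Psi(\boldsymbol\xi,s)\ge c_1k(\boldsymbol\xi)s^2$ for all $\boldsymbol\xi\in\mathbb R^d$ and $|s|<\delta_0$. iv) There is $c_2>0$ such that $k(\boldsymbol\xi)\left|\frac{\partial^2\Psi}{\partial s^2}(\boldsymbol\xi,s)\right|\le c_2k(\boldsymbol\xi)$ for all $\boldsymbol\xi\in\mathbb R^d$ and $|s|<\delta_0$. Assume also that $\rho(\boldsymbol\xi):=k(\boldsymbol\xi)\frac{\partial^2\Psi}{\partial s^2}(\boldsymbol\xi,0)$ belongs to $L^1_{loc}(\mathbb R^d)$. Let $\boldsymbol\ell\in L^2(\Omega;\mathbb R^d)$ and, for $\varepsilon>0$ and $\mathbf u\in L^2(\Omega;\mathbb R^d)$, set $$E_\varepsilon(\mathbf u)=\frac1{\varepsilon^2}\int_\Omega\int_\Omega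 w\big(\mathbf y-\mathbf x,\ |\mathcal D\mathbf i(\mathbf y,\mathbf x)+\varepsilon\mathcal D\mathbf u(\mathbf y,\mathbf x)|-1\big)\,d\mathbf y\,d\mathbf x-\int_\Omega\boldsymbol\ell\cdot\mathbf u\,d\mathbf x\in(-\infty,+\infty],$$ with $\overline E_\varepsilon(\mathbf u)=E_\varepsilon(\mathbf u)$ if $E_\varepsilon(\mathbf u)<\infty$ and $\overline E_\varepsilon(\mathbf u)=+\infty$ otherwise. Let $$\mathcal X_\rho(\Omega)=\Big\{\mathbf u\in L^2(\Omega;\mathbb R^d):\int_\Omega\int_\Omega\rho(\mathbf y-\mathbf x)\,(\mathcal D\mathbf u(\mathbf y,\mathbf x)\cdot\mathcal D\mathbf i(\mathbf y,\mathbf x))^2\,d\mathbf y\,d\mathbf x<\infty\Big\},$$ and let $\overline E_0:L^2(\Omega;\mathbb R^d)\to(-\infty,+\infty]$ be given by $$\overline E_0(\mathbf u)=\frac12\int_\Omega\int_\Omega\rho(\mathbf y-\mathbf x)\,(\mathcal D\mathbf u(\mathbf y,\mathbf x)\cdot\mathcal D\mathbf i(\mathbf y,\mathbf x))^2\,d\mathbf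 y\,d\mathbf x-\int_\Omega\boldsymbol\ell\cdot\mathbf u\,d\mathbf x$$ for $\mathbf u\in\mathcal X_\rho(\Omega)$ and $\overline E_0(\mathbf u)=+\infty$ for $\mathbf u\in L^2(\Omega;\mathbb R^d)\setminus\mathcal X_\rho(\Omega)$. Then $\overline E_\varepsilon$ $\Gamma$-converges to $\overline E_0$ as $\varepsilon\to0^+$ with respect to the strong topology of $L^2(\Omega;\mathbb R^d)$: for every sequence $\varepsilon_n\to0^+$ and every $\mathbf u\in L^2(\Omega;\mathbb R^d)$, one has $\overline E_0(\mathbf u)\le\liminf_n\overline E_{\varepsilon_n}(\mathbf u_n)$ whenever $\mathbf u_n\to\mathbf u$ in $L^2(\Omega;\mathbb R^d)$, and there is a sequence $\mathbf u_n\to\mathbf u$ in $L^2(\Omega;\mathbb R^d)$ with $\limsup_n\overline E_{\varepsilon_n}(\mathbf u_n)\le\overline E_0(\mathbf u)$. -/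

import Mathlib

open MeasureTheory Set Filter Topology
open scoped ENNReal

/-- A set with Lipschitz boundary: near each boundary point `x₀`, the set is, in some direction `e`,
the region strictly above the graph of a Lipschitz function of the component orthogonal to `e`. -/
def HasLipschitzBoundary {d : ℕ} (Ω : Set (EuclideanSpace ℝ (Fin d))) : Prop :=
  ∀ x₀ ∈ frontier Ω, ∃ r > (0 : ℝ), ∃ e : EuclideanSpace ℝ (Fin d), ‖e‖ = 1 ∧
    ∃ (K : NNReal) (γ : EuclideanSpace ℝ (Fin d) → ℝ), LipschitzWith K γ ∧
      ∀ x ∈ Metric.ball x₀ r, x ∈ Ω ↔ γ (x - inner ℝ x e • e) < inner ℝ x e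

/-- The vector difference quotient `𝒟v(y, x) = (v(y) - v(x)) / |y - x|`. -/
noncomputable def diffQuot {d : ℕ} (v : EuclideanSpace ℝ (Fin d) → EuclideanSpace ℝ (Fin d))
    (y x : EuclideanSpace ℝ (Fin d)) : EuclideanSpace ℝ (Fin d) :=
  ‖y - x‖⁻¹ • (v y - v x)

/-- The structural conditions on the microelastic potential `w(ξ, s) = k(ξ) Ψ(ξ, s)`, `s ≥ -1`.
Values of `Ψ ξ s` for `s < -1` play no role. The radius `δ₀` is taken at most `1`, so that
`(-δ₀, δ₀)` lies in the domain `[-1, ∞)`. -/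
structure IsMicroelasticPotential {d : ℕ} (k : EuclideanSpace ℝ (Fin d) → ℝ)
    (Ψ : EuclideanSpace ℝ (Fin d) → ℝ → ℝ) (δ₀ : ℝ) : Prop where
  radius_pos : 0 < δ₀
  radius_le_one : δ₀ ≤ 1
  /-- `w` takes values in `[0, ∞)`. -/
  nonneg : ∀ ξ, ∀ s ≥ (-1 : ℝ), 0 ≤ k ξ * Ψ ξ s
  /-- `Ψ` is a Carathéodory function: (Lebesgue) measurable in `ξ`; its continuity in `s` is
  contained in the next field. -/
  measurable_left : ∀ s ≥ (-1 : ℝ), AEMeasurable (fun ξ => Ψ ξ s) volume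
  /-- `Ψ(ξ, ·)` is locally Lipschitz on `[-1, ∞)`. -/
  locallyLipschitz_right : ∀ ξ, LocallyLipschitzOn (Ici (-1)) (Ψ ξ)
  /-- `Ψ(ξ, ·)` is of class `C²` on `[0, δ₀]`. -/
  contDiffOn : ∀ ξ, ContDiffOn ℝ 2 (Ψ ξ) (Icc 0 δ₀)
  /-- `Ψ(ξ, ·)` is twice differentiable on `(-δ₀, δ₀)`. -/
  twice_differentiable : ∀ ξ, ∀ s ∈ Ioo (-δ₀) δ₀,
    DifferentiableAt ℝ (Ψ ξ) s ∧ DifferentiableAt ℝ (deriv (Ψ ξ)) s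
  zero : ∀ ξ, Ψ ξ 0 = 0
  deriv_zero : ∀ ξ, deriv (Ψ ξ) 0 = 0
  deriv_two_pos : ∀ ξ, 0 < iteratedDeriv 2 (Ψ ξ) 0
  /-- `inf_{|s| ≥ s₀} inf_ξ Ψ(ξ, s) > 0` for all `s₀ > 0`. -/
  inf_pos : ∀ s₀ > (0 : ℝ), ∃ c > (0 : ℝ), ∀ ξ, ∀ s ≥ (-1 : ℝ), s₀ ≤ |s| → c ≤ Ψ ξ s
  lower_bound : ∃ c₁ > (0 : ℝ), ∀ ξ s, |s| < δ₀ → c₁ * k ξ * s ^ 2 ≤ k ξ * Ψ ξ s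
  upper_bound : ∃ c₂ > (0 : ℝ), ∀ ξ s, |s| < δ₀ → k ξ * |iteratedDeriv 2 (Ψ ξ) s| ≤ c₂ * k ξ

/-- The linearized kernel `ρ(ξ) = k(ξ) ∂²Ψ/∂s²(ξ, 0)`. -/
noncomputable def linKernel {d : ℕ} (k : EuclideanSpace ℝ (Fin d) → ℝ)
    (Ψ : EuclideanSpace ℝ (Fin d) → ℝ → ℝ) (ξ : EuclideanSpace ℝ (Fin d)) : ℝ :=
  k ξ * iteratedDeriv 2 (Ψ ξ) 0

/-- The space `L²(Ω; ℝᵈ)`. -/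
abbrev L2Field {d : ℕ} (Ω : Set (EuclideanSpace ℝ (Fin d))) : Type :=
  Lp (EuclideanSpace ℝ (Fin d)) 2 (volume.restrict Ω)

/-- The work `∫_Ω ℓ · u` of the external load. -/
noncomputable def loadWork {d : ℕ} {Ω : Set (EuclideanSpace ℝ (Fin d))} (l u : L2Field Ω) : ℝ :=
  ∫ x in Ω, inner ℝ (l x) (u x)

/-- The rescaled nonlinear energy
`E_ε(u) = ε⁻² ∬ w(y - x, |𝒟id(y, x) + ε 𝒟u(y, x)| - 1) dy dx - ∫ ℓ · u`, in `(-∞, ∞]`. -/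
noncomputable def nonlinearEnergy {d : ℕ} {Ω : Set (EuclideanSpace ℝ (Fin d))}
    (w : EuclideanSpace ℝ (Fin d) → ℝ → ℝ) (l : L2Field Ω) (ε : ℝ) (u : L2Field Ω) : EReal :=
  ((ENNReal.ofReal (ε ^ 2)⁻¹ *
      ∫⁻ x in Ω, ∫⁻ y in Ω,
        ENNReal.ofReal (w (y - x) (‖diffQuot id y x + ε • diffQuot u y x‖ - 1)) : ℝ≥0∞) : EReal)
    - ((loadWork l u : ℝ) : EReal)

open Classical in
/-- The extension of `E_ε` by `+∞` where it is not finite. -/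
noncomputable def extNonlinearEnergy {d : ℕ} {Ω : Set (EuclideanSpace ℝ (Fin d))}
    (w : EuclideanSpace ℝ (Fin d) → ℝ → ℝ) (l : L2Field Ω) (ε : ℝ) (u : L2Field Ω) : EReal :=
  if nonlinearEnergy w l ε u < ⊤ then nonlinearEnergy w l ε u else ⊤

/-- The quadratic form `∬ ρ(y - x) (𝒟u(y, x) · 𝒟id(y, x))² dy dx`, in `[0, ∞]`. -/
noncomputable def bondForm {d : ℕ} {Ω : Set (EuclideanSpace ℝ (Fin d))}
    (ρ : EuclideanSpace ℝ (Fin d) → ℝ) (u : L2Field Ω) : ℝ≥0∞ :=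
  ∫⁻ x in Ω, ∫⁻ y in Ω,
    ENNReal.ofReal (ρ (y - x) * inner ℝ (diffQuot u y x) (diffQuot id y x) ^ 2)

/-- The space `𝒳_ρ(Ω)` of the fields `u ∈ L²(Ω; ℝᵈ)` whose quadratic form is finite. -/
def bondSpace {d : ℕ} (Ω : Set (EuclideanSpace ℝ (Fin d)))
    (ρ : EuclideanSpace ℝ (Fin d) → ℝ) : Set (L2Field Ω) :=
  {u | bondForm ρ u < ∞}

/-- The linearized bond-based energy
`E_0(u) = ½ ∬ ρ(y - x) (𝒟u(y, x) · 𝒟id(y, x))² dy dx - ∫ ℓ · u`. -/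
noncomputable def linearizedEnergy {d : ℕ} {Ω : Set (EuclideanSpace ℝ (Fin d))}
    (ρ : EuclideanSpace ℝ (Fin d) → ℝ) (l : L2Field Ω) (u : L2Field Ω) : EReal :=
  (((2 : ℝ≥0∞)⁻¹ * bondForm ρ u : ℝ≥0∞) : EReal) - ((loadWork l u : ℝ) : EReal)

open Classical in
/-- The energy `E_0` on `𝒳_ρ(Ω)`, extended by `+∞` to the rest of `L²(Ω; ℝᵈ)`. -/
noncomputable def extLinearizedEnergy {d : ℕ} {Ω : Set (EuclideanSpace ℝ (Fin d))}
    (ρ : EuclideanSpace ℝ (Fin d) → ℝ) (l : L2Field Ω) (u : L2Field Ω) : EReal :=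
  if u ∈ bondSpace Ω ρ then linearizedEnergy ρ l u else ⊤

/-- `Γ`-convergence of `F ε` to `F₀` as `ε → 0⁺` on a metric space: along every sequence `ε_n → 0⁺`
the liminf inequality holds and every point has a recovery sequence. -/
def GammaConvergesZero {X : Type*} [MetricSpace X] (F : ℝ → X → EReal) (F₀ : X → EReal) : Prop :=
  ∀ ε : ℕ → ℝ, (∀ n, 0 < ε n) → Tendsto ε atTop (𝓝 0) →
    ∀ u : X,
      (∀ v : ℕ → X, Tendsto v atTop (𝓝 u) →
        F₀ u ≤ liminf (fun n => F (ε n) (v n)) atTop) ∧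
      (∃ v : ℕ → X, Tendsto v atTop (𝓝 u) ∧
        limsup (fun n => F (ε n) (v n)) atTop ≤ F₀ u)

/-! With strain `s = |𝒟id + ε𝒟u| - 1`, the norm has derivative `𝒟u · 𝒟id` at the unit vector `𝒟id`,
so `s / ε → 𝒟u · 𝒟id`. Since `w(ξ, s) = ρ(ξ) s² / 2 + o(s²)`, the density `ε⁻² w` tends pointwise to
half the quadratic density. The lower bound is then Fatou's lemma along an a.e. convergent
subsequence (`bondEnergy_le_liminf_storedEnergy_of_tendsto`).

For the upper bound, conditions iii) and iv) give `w ≤ C ρ s²` for small `s`. On a Lipschitz field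
the strain is `O(ε)` uniformly, and `ρ(y - x)` is integrable on the bounded set `Ω × Ω`, so
dominated convergence makes the constant sequence a recovery sequence
(`tendsto_storedEnergy_of_lipschitz`). A diagonal argument concludes once Lipschitz fields are dense
in energy.

Density has two stages. First (`exists_lipschitz_approx_bounded`), a partition of unity localizes
the field near points where a cone of directions leads into `Ω`. Averages over such translates are
smooth, and by Jensen's inequality and translation invariance of the kernel they do not increase the
energy. The cutoffs cost only a multiple of the squared `L²` norm, so the approximants have bounded
energy. Second (`exists_lipschitz_bondEnergy_le_add`), bounded energy is improved to almost optimal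
energy by the parallelogram identity, as in the projection theorem: near-minimizers over shrinking
convex neighbourhoods of `u` are close to each other in energy, hence by lower semicontinuity close
to `u`. -/

/-! ### Taylor estimates in one variable -/

open Asymptotics in
/-- Second order Taylor expansion at a critical zero, under twice differentiability only. -/
theorem isLittleO_sub_iteratedDeriv_two {f : ℝ → ℝ} (hd : ∀ᶠ s in 𝓝 (0 : ℝ), DifferentiableAt ℝ f s)
    (h2 : DifferentiableAt ℝ (deriv f) 0) (h0 : f 0 = 0) (h1 : deriv f 0 = 0) :
    (fun s => f s - iteratedDeriv 2 f 0 / 2 * s ^ 2) =o[𝓝 0] fun s => s ^ 2 := by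
  set a := iteratedDeriv 2 f 0 with ha
  have ha' : HasDerivAt (deriv f) a 0 := by
    have h := h2.hasDerivAt
    rwa [show deriv (deriv f) 0 = a by rw [ha, iteratedDeriv_succ, iteratedDeriv_one]] at h
  have hlo := ha'.isLittleO
  simp only [h1, sub_zero, smul_eq_mul] at hlo
  rw [isLittleO_iff] at hlo ⊢
  intro η hη
  obtain ⟨δ, hδ, hball⟩ := Metric.eventually_nhds_iff_ball.1 ((hlo hη).and hd)
  refine Metric.eventually_nhds_iff_ball.2 ⟨δ, hδ, fun s hs => ?_⟩
  have hsub : Metric.closedBall (0 : ℝ) |s| ⊆ Metric.ball 0 δ := by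
    apply Metric.closedBall_subset_ball
    simpa using hs
  -- Mean value inequality for the remainder: its derivative `f' - a x` is at most `η |x| ≤ η |s|`
  -- by differentiability of `f'` at 0 alone.
  have key := (convex_closedBall (0 : ℝ) |s|).norm_image_sub_le_of_norm_hasDerivWithin_le
    (f := fun s => f s - a / 2 * s ^ 2) (f' := fun s => deriv f s - a * s) (C := η * |s|)
    (x := 0) (y := s) ?_ ?_ (by simp) (by simp)
  · simp only [h0, Real.norm_eq_abs] at key ⊢
    rw [abs_pow, pow_two |s|, ← mul_assoc]
    simpa using key
  · intro x hx
    have h := ((hball x (hsub hx)).2.hasDerivAt.sub (((hasDerivAt_id x).pow 2).const_mul (a / 2)))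
    refine (h.congr_deriv ?_).hasDerivWithinAt
    simp
    ring
  · intro x hx
    have h := (hball x (hsub hx)).1
    rw [mul_comm a x]
    refine h.trans ?_
    gcongr
    simpa using hx

/-- Quadratic upper bound for a function with bounded second derivative. -/
theorem abs_le_mul_sq_of_iteratedDeriv_two_le {f : ℝ → ℝ} {δ c : ℝ}
    (hd : ∀ s ∈ Ioo (-δ) δ, DifferentiableAt ℝ f s ∧ DifferentiableAt ℝ (deriv f) s)
    (h0 : f 0 = 0) (h1 : deriv f 0 = 0) (hb : ∀ s, |s| < δ → |iteratedDeriv 2 f s| ≤ c)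
    {s : ℝ} (hs : |s| < δ) : |f s| ≤ c * s ^ 2 := by
  have hsub : ∀ x ∈ Metric.closedBall (0 : ℝ) |s|, |x| < δ := fun x hx =>
    lt_of_le_of_lt (by simpa using hx) hs
  have hc : 0 ≤ c := (abs_nonneg _).trans (hb s hs)
  have hderiv : ∀ x ∈ Metric.closedBall (0 : ℝ) |s|, |deriv f x| ≤ c * |s| := by
    intro x hx
    have key := (convex_closedBall (0 : ℝ) |s|).norm_image_sub_le_of_norm_hasDerivWithin_le
      (f := deriv f) (f' := deriv (deriv f)) (C := c) (x := 0) (y := x)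
      (fun y hy => ((hd y (abs_lt.1 (hsub y hy))).2.hasDerivAt).hasDerivWithinAt)
      (fun y hy => ?_) (by simp) hx
    · rw [h1, sub_zero, sub_zero] at key
      exact key.trans (mul_le_mul_of_nonneg_left (by simpa using hx) hc)
    · have := hb y (hsub y hy)
      rwa [iteratedDeriv_succ, iteratedDeriv_one] at this
  have key := (convex_closedBall (0 : ℝ) |s|).norm_image_sub_le_of_norm_hasDerivWithin_le
    (f := f) (f' := deriv f) (C := c * |s|) (x := 0) (y := s)
    (fun y hy => ((hd y (abs_lt.1 (hsub y hy))).1.hasDerivAt).hasDerivWithinAt) hderiv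
    (by simp) (by simp)
  rw [h0, sub_zero, sub_zero] at key
  calc |f s| ≤ c * |s| * |s| := key
    _ = c * s ^ 2 := by rw [mul_assoc, ← pow_two, sq_abs]

/-! ### Bounds and measurability of the potential -/

namespace IsMicroelasticPotential

variable {d : ℕ} {k : EuclideanSpace ℝ (Fin d) → ℝ} {Ψ : EuclideanSpace ℝ (Fin d) → ℝ → ℝ} {δ₀ : ℝ}

/-- Since `Ψ(ξ, 1) > 0`, the sign of `w(ξ, 1)` is that of `k ξ`. -/
theorem kernel_nonneg (hw : IsMicroelasticPotential k Ψ δ₀) (ξ : EuclideanSpace ℝ (Fin d)) :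
    0 ≤ k ξ := by
  obtain ⟨c, hc, h⟩ := hw.inf_pos 1 one_pos
  have h1 := h ξ 1 (by norm_num) (by simp)
  exact nonneg_of_mul_nonneg_left (hw.nonneg ξ 1 (by norm_num)) (hc.trans_le h1)

theorem isLittleO (hw : IsMicroelasticPotential k Ψ δ₀) (ξ : EuclideanSpace ℝ (Fin d)) :
    (fun s => Ψ ξ s - iteratedDeriv 2 (Ψ ξ) 0 / 2 * s ^ 2) =o[𝓝 0] fun s => s ^ 2 := by
  have hI : Ioo (-δ₀) δ₀ ∈ 𝓝 (0 : ℝ) :=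
    Ioo_mem_nhds (neg_lt_zero.2 hw.radius_pos) hw.radius_pos
  exact isLittleO_sub_iteratedDeriv_two
    (mem_of_superset hI fun s hs => (hw.twice_differentiable ξ s hs).1)
    (hw.twice_differentiable ξ 0 (mem_of_mem_nhds hI)).2 (hw.zero ξ) (hw.deriv_zero ξ)

/-- The Taylor expansion exhibits the second derivative as the limit of the measurable quotients `2
Ψ(ξ, s) / s²` along `s = 1 / (n + 1)`. -/
theorem aemeasurable_iteratedDeriv (hw : IsMicroelasticPotential k Ψ δ₀) :
    AEMeasurable (fun ξ => iteratedDeriv 2 (Ψ ξ) 0) volume := by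
  have hlim : Tendsto (fun n : ℕ => (1 : ℝ) / (n + 1)) atTop (𝓝 0) :=
    tendsto_one_div_add_atTop_nhds_zero_nat
  refine aemeasurable_of_tendsto_metrizable_ae'
    (f := fun (n : ℕ) ξ => 2 * (Ψ ξ (1 / (n + 1)) / (1 / ((n : ℝ) + 1)) ^ 2)) (fun n => ?_)
    (Eventually.of_forall fun ξ => ?_)
  · refine ((hw.measurable_left _ ?_).div_const _).const_mul _
    have : (0 : ℝ) < 1 / (n + 1) := by positivity
    linarith
  · have h := ((hw.isLittleO ξ).comp_tendsto hlim).tendsto_div_nhds_zero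
    have h2 := (h.add_const (iteratedDeriv 2 (Ψ ξ) 0 / 2)).const_mul 2
    rw [zero_add, mul_div_cancel₀ _ (two_ne_zero)] at h2
    refine h2.congr fun n => ?_
    have : (1 / ((n : ℝ) + 1)) ^ 2 ≠ 0 := by positivity
    simp only [Function.comp]
    rw [sub_div, mul_div_cancel_right₀ _ this, sub_add_cancel]

/-- Dividing the lower bound iii) by `s²` and letting `s → 0` gives `c₁ k ≤ ρ / 2`. -/
theorem kernel_le (hw : IsMicroelasticPotential k Ψ δ₀) :
    ∃ C > 0, ∀ ξ, k ξ ≤ C * linKernel k Ψ ξ := by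
  obtain ⟨c, hc, hlow⟩ := hw.lower_bound
  refine ⟨(2 * c)⁻¹, by positivity, fun ξ => ?_⟩
  have h := (hw.isLittleO ξ).tendsto_div_nhds_zero
  have h' := ((h.add_const (iteratedDeriv 2 (Ψ ξ) 0 / 2)).const_mul (k ξ)).mono_left
    (nhdsWithin_le_nhds (s := {0}ᶜ))
  have hev : ∀ᶠ s in 𝓝[≠] (0 : ℝ), c * k ξ ≤
      k ξ * ((Ψ ξ s - iteratedDeriv 2 (Ψ ξ) 0 / 2 * s ^ 2) / s ^ 2
        + iteratedDeriv 2 (Ψ ξ) 0 / 2) := by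
    have hI : ∀ᶠ s in 𝓝[≠] (0 : ℝ), |s| < δ₀ := by
      refine nhdsWithin_le_nhds (Metric.eventually_nhds_iff_ball.2 ⟨δ₀, hw.radius_pos, ?_⟩)
      intro s hs
      simpa using hs
    filter_upwards [hI, self_mem_nhdsWithin] with s hs hs0
    have hs2 : 0 < s ^ 2 := by
      have : s ≠ 0 := hs0
      positivity
    have := hlow ξ s hs
    rw [show (Ψ ξ s - iteratedDeriv 2 (Ψ ξ) 0 / 2 * s ^ 2) / s ^ 2 + iteratedDeriv 2 (Ψ ξ) 0 / 2
      = Ψ ξ s / s ^ 2 by rw [sub_div, mul_div_cancel_right₀ _ hs2.ne', sub_add_cancel], mul_div_assoc', le_div_iff₀ hs2]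
    exact this
  have := ge_of_tendsto h' hev
  rw [zero_add] at this
  rw [linKernel, inv_mul_eq_div, le_div_iff₀ (by positivity)]
  linarith

theorem potential_le (hw : IsMicroelasticPotential k Ψ δ₀) :
    ∃ C ≥ 0, ∀ ξ s, |s| < δ₀ → k ξ * Ψ ξ s ≤ C * linKernel k Ψ ξ * s ^ 2 := by
  obtain ⟨C, hC, hk⟩ := hw.kernel_le
  obtain ⟨c, hc, hup⟩ := hw.upper_bound
  refine ⟨c * C, by positivity, fun ξ s hs => ?_⟩
  -- Condition iv) bounds the second derivative of `Ψ` only where `k ξ` can be cancelled.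
  rcases (hw.kernel_nonneg ξ).eq_or_lt with h0 | hpos
  · rw [linKernel, ← h0]
    simp
  · have h := abs_le_mul_sq_of_iteratedDeriv_two_le (hw.twice_differentiable ξ) (hw.zero ξ)
      (hw.deriv_zero ξ) (c := c) (fun s hs => ?_) hs
    · calc k ξ * Ψ ξ s ≤ k ξ * (c * s ^ 2) :=
            mul_le_mul_of_nonneg_left ((le_abs_self _).trans h) hpos.le
        _ ≤ (C * linKernel k Ψ ξ) * (c * s ^ 2) :=
            mul_le_mul_of_nonneg_right (hk ξ) (by positivity)
        _ = _ := by ring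
    · have := hup ξ s hs
      rw [mul_comm c] at this
      exact le_of_mul_le_mul_left this hpos

theorem linKernel_nonneg (hw : IsMicroelasticPotential k Ψ δ₀) (ξ : EuclideanSpace ℝ (Fin d)) :
    0 ≤ linKernel k Ψ ξ :=
  mul_nonneg (hw.kernel_nonneg ξ) (hw.deriv_two_pos ξ).le

/-- Measurability of `k` is not among the structural conditions; it follows by dividing `ρ` by the
positive second derivative. -/
theorem aemeasurable_kernel (hw : IsMicroelasticPotential k Ψ δ₀)
    (hρ : AEMeasurable (linKernel k Ψ) volume) : AEMeasurable k volume := by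
  refine (hρ.div hw.aemeasurable_iteratedDeriv).congr (Eventually.of_forall fun ξ => ?_)
  exact mul_div_cancel_right₀ _ (hw.deriv_two_pos ξ).ne'

/-- A Borel representative of the potential and of the linearized kernel, for which all structural
properties hold at every point. -/
theorem exists_borel_representative (hw : IsMicroelasticPotential k Ψ δ₀)
    (hρ : AEMeasurable (linKernel k Ψ) volume) :
    ∃ (W : EuclideanSpace ℝ (Fin d) → ℝ → ℝ) (R : EuclideanSpace ℝ (Fin d) → ℝ) (C : ℝ),
      Measurable (Function.uncurry W) ∧ Measurable R ∧ 0 ≤ C ∧ (∀ ξ, 0 ≤ R ξ) ∧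
      (∀ᵐ ξ, linKernel k Ψ ξ = R ξ ∧ ∀ s ≥ -1, k ξ * Ψ ξ s = W ξ s) ∧
      (∀ ξ s, |s| < δ₀ → W ξ s ≤ C * R ξ * s ^ 2) ∧
      (∀ ξ, (fun s => W ξ s - R ξ / 2 * s ^ 2) =o[𝓝 0] fun s => s ^ 2) := by
  have hk := hw.aemeasurable_kernel hρ
  -- Rational `s` leave only countably many null sets to discard, and continuity in `s` recovers all
  -- real `s`. Truncation at `-1` extends `Ψ ξ` continuously to the whole line.
  have hq : ∀ q : ℚ, AEMeasurable (fun ξ => Ψ ξ (max q (-1))) volume := fun q =>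
    hw.measurable_left _ (le_max_right _ _)
  have hgood : ∀ᵐ ξ, k ξ = hk.mk k ξ ∧ linKernel k Ψ ξ = hρ.mk _ ξ ∧
      ∀ q : ℚ, Ψ ξ (max q (-1)) = (hq q).mk _ ξ :=
    hk.ae_eq_mk.and (hρ.ae_eq_mk.and (ae_all_iff.2 fun q => (hq q).ae_eq_mk))
  obtain ⟨G, hG, hGm, hG0⟩ := exists_measurable_superset_of_null (ae_iff.1 hgood)
  have hGc : ∀ ξ ∉ G, k ξ = hk.mk k ξ ∧ linKernel k Ψ ξ = hρ.mk _ ξ ∧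
      ∀ q : ℚ, Ψ ξ (max q (-1)) = (hq q).mk _ ξ := fun ξ hξ => by
    by_contra h
    exact hξ (hG h)
  obtain ⟨C, hC, hle⟩ := hw.potential_le
  have hcont : ∀ ξ, Continuous fun s : ℝ => Ψ ξ (max s (-1)) := fun ξ =>
    (hw.locallyLipschitz_right ξ).continuousOn.comp_continuous
      (continuous_id.max continuous_const) fun s => mem_Ici.2 (le_max_right _ _)
  have hWcont : ∀ ξ, Continuous fun s : ℝ => Gᶜ.indicator (fun ξ => k ξ * Ψ ξ (max s (-1))) ξ := by
    intro ξ
    by_cases hξ : ξ ∈ G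
    · simpa [hξ] using continuous_const
    · simpa [hξ] using (hcont ξ).const_mul (k ξ)
  refine ⟨fun ξ s => Gᶜ.indicator (fun ξ => k ξ * Ψ ξ (max s (-1))) ξ,
    Gᶜ.indicator (linKernel k Ψ), C, ?_, ?_, hC, ?_, ?_, ?_, ?_⟩
  · have hrat : ∀ q : ℚ,
        Measurable (Gᶜ.indicator fun ξ => k ξ * Ψ ξ (max (q : ℝ) (-1))) := fun q => by
      have : Gᶜ.indicator (fun ξ => k ξ * Ψ ξ (max (q : ℝ) (-1)))
          = Gᶜ.indicator (fun ξ => hk.mk k ξ * (hq q).mk _ ξ) :=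
        indicator_congr fun ξ hξ => by rw [← (hGc ξ hξ).1, ← (hGc ξ hξ).2.2 q]
      rw [this]
      exact (hk.measurable_mk.mul (hq q).measurable_mk).indicator hGm.compl
    have hreal : ∀ s : ℝ, Measurable (Gᶜ.indicator fun ξ => k ξ * Ψ ξ (max s (-1))) := by
      intro s
      obtain ⟨x, hx, hxs⟩ := mem_closure_iff_seq_limit.1 (Rat.denseRange_cast (𝕜 := ℝ) s)
      refine measurable_of_tendsto_metrizable (f := fun (n : ℕ) =>
        Gᶜ.indicator fun ξ => k ξ * Ψ ξ (max (x n) (-1))) (fun n => ?_) ?_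
      · obtain ⟨q, hqn⟩ := hx n
        rw [← hqn]
        exact hrat q
      · exact tendsto_pi_nhds.2 fun ξ => ((hWcont ξ).tendsto s).comp hxs
    have := measurable_uncurry_of_continuous_of_measurable hWcont hreal
    exact this.comp measurable_swap
  · rw [show Gᶜ.indicator (linKernel k Ψ) = Gᶜ.indicator (hρ.mk _) from
      indicator_congr fun ξ hξ => (hGc ξ hξ).2.1]
    exact hρ.measurable_mk.indicator hGm.compl
  · exact fun ξ => indicator_nonneg (fun ξ _ => hw.linKernel_nonneg ξ) ξ
  · filter_upwards [compl_mem_ae_iff.2 hG0] with ξ hξ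
    have hξ' : ξ ∉ G := hξ
    refine ⟨by simp [hξ'], fun s hs => by simp [hξ', max_eq_left hs]⟩
  · intro ξ s hs
    by_cases hξ : ξ ∈ G
    · simp [hξ]
    · have : -1 ≤ s := by linarith [(abs_lt.1 hs).1, hw.radius_le_one]
      simpa [hξ, max_eq_left this] using hle ξ s hs
  · intro ξ
    by_cases hξ : ξ ∈ G
    · simp [hξ]
    · refine ((hw.isLittleO ξ).const_mul_left (k ξ)).congr' ?_ EventuallyEq.rfl
      filter_upwards [Ioi_mem_nhds (show (-1 : ℝ) < 0 by norm_num)] with s hs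
      have : -1 ≤ s := le_of_lt hs
      simp [hξ, max_eq_left this, linKernel]
      ring

end IsMicroelasticPotential

/-! ### Energies as integrals over pairs, and their pointwise limit -/

section BondEnergy

variable {d : ℕ}

local notation "𝔼" => EuclideanSpace ℝ (Fin d)

/-- The projected difference quotient `𝒟f(y, x) · 𝒟id(y, x)` at the pair `p = (x, y)`. -/
noncomputable def bondQuot (f : 𝔼 → 𝔼) (p : 𝔼 × 𝔼) : ℝ :=
  inner ℝ (diffQuot f p.2 p.1) (diffQuot id p.2 p.1)

/-- The quadratic form of `bondForm` for functions, as an integral over the product. -/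
noncomputable def bondEnergy (Ω : Set 𝔼) (R : 𝔼 → ℝ) (f : 𝔼 → 𝔼) : ℝ≥0∞ :=
  ∫⁻ p in Ω ×ˢ Ω, ENNReal.ofReal (R (p.2 - p.1) * bondQuot f p ^ 2)

/-- The rescaled nonlinear stored energy for functions, as an integral over the product. -/
noncomputable def storedEnergy (Ω : Set 𝔼) (W : 𝔼 → ℝ → ℝ) (ε : ℝ) (f : 𝔼 → 𝔼) : ℝ≥0∞ :=
  ∫⁻ p in Ω ×ˢ Ω, ENNReal.ofReal (ε ^ 2)⁻¹ * ENNReal.ofReal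
    (W (p.2 - p.1) (‖diffQuot id p.2 p.1 + ε • diffQuot f p.2 p.1‖ - 1))

theorem diffQuot_add (f g : 𝔼 → 𝔼) (y x : 𝔼) :
    diffQuot (f + g) y x = diffQuot f y x + diffQuot g y x := by
  simp only [diffQuot, Pi.add_apply, ← smul_add]
  congr 1
  abel

theorem diffQuot_smul (c : ℝ) (f : 𝔼 → 𝔼) (y x : 𝔼) :
    diffQuot (c • f) y x = c • diffQuot f y x := by
  simp only [diffQuot, Pi.smul_apply, ← smul_sub]
  rw [smul_comm]

theorem bondQuot_add (f g : 𝔼 → 𝔼) (p : 𝔼 × 𝔼) :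
    bondQuot (f + g) p = bondQuot f p + bondQuot g p := by
  simp only [bondQuot, diffQuot_add, inner_add_left]

theorem bondQuot_smul (c : ℝ) (f : 𝔼 → 𝔼) (p : 𝔼 × 𝔼) :
    bondQuot (c • f) p = c * bondQuot f p := by
  simp only [bondQuot, diffQuot_smul, real_inner_smul_left]

theorem bondQuot_sub (f g : 𝔼 → 𝔼) (p : 𝔼 × 𝔼) :
    bondQuot (f - g) p = bondQuot f p - bondQuot g p := by
  have h := bondQuot_add (f - g) g p
  rw [sub_add_cancel] at h
  linarith

theorem bondQuot_sum {ι : Type*} (s : Finset ι) (f : ι → 𝔼 → 𝔼) (p : 𝔼 × 𝔼) :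
    bondQuot (∑ i ∈ s, f i) p = ∑ i ∈ s, bondQuot (f i) p := by
  classical
  induction s using Finset.induction_on with
  | empty => simp [bondQuot, diffQuot]
  | insert i s hi ih => rw [Finset.sum_insert hi, Finset.sum_insert hi, bondQuot_add, ih]

theorem norm_diffQuot_id_le (y x : 𝔼) : ‖diffQuot id y x‖ ≤ 1 := by
  rw [diffQuot, norm_smul, norm_inv, norm_norm]
  exact inv_mul_le_one

theorem norm_diffQuot_id {y x : 𝔼} (h : y - x ≠ 0) : ‖diffQuot id y x‖ = 1 := by
  rw [diffQuot, norm_smul, norm_inv, norm_norm]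
  exact inv_mul_cancel₀ (norm_ne_zero_iff.2 h)

theorem measurable_diffQuot {f : 𝔼 → 𝔼} (hf : Measurable f) :
    Measurable fun p : 𝔼 × 𝔼 => diffQuot f p.2 p.1 := by
  unfold diffQuot
  fun_prop

theorem measurable_bondQuot {f : 𝔼 → 𝔼} (hf : Measurable f) : Measurable (bondQuot f) :=
  (measurable_diffQuot hf).inner (measurable_diffQuot measurable_id)

theorem measurable_bondDensity {R : 𝔼 → ℝ} (hR : Measurable R) {f : 𝔼 → 𝔼} (hf : Measurable f) :
    Measurable fun p : 𝔼 × 𝔼 => ENNReal.ofReal (R (p.2 - p.1) * bondQuot f p ^ 2) := by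
  have := measurable_bondQuot hf
  fun_prop

theorem measurable_storedDensity {W : 𝔼 → ℝ → ℝ} (hW : Measurable (Function.uncurry W))
    {f : 𝔼 → 𝔼} (hf : Measurable f) (ε : ℝ) :
    Measurable fun p : 𝔼 × 𝔼 => ENNReal.ofReal (ε ^ 2)⁻¹ * ENNReal.ofReal
      (W (p.2 - p.1) (‖diffQuot id p.2 p.1 + ε • diffQuot f p.2 p.1‖ - 1)) := by
  have h1 := measurable_diffQuot hf
  have h2 := measurable_diffQuot (d := d) measurable_id
  have h3 : Measurable fun p : 𝔼 × 𝔼 =>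
      (p.2 - p.1, ‖diffQuot id p.2 p.1 + ε • diffQuot f p.2 p.1‖ - 1) :=
    (measurable_snd.sub measurable_fst).prodMk (((h2.add (h1.const_smul ε)).norm).sub_const 1)
  exact ((hW.comp h3).ennreal_ofReal).const_mul _

theorem volume_restrict_prod (Ω : Set 𝔼) :
    (volume.restrict Ω).prod (volume.restrict Ω) = (volume : Measure (𝔼 × 𝔼)).restrict (Ω ×ˢ Ω) := by
  rw [Measure.prod_restrict, Measure.volume_eq_prod]

theorem ae_sub_of_ae {P : 𝔼 → Prop} (h : ∀ᵐ ξ, P ξ) (x : 𝔼) (Ω : Set 𝔼) :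
    ∀ᵐ y ∂(volume.restrict Ω), P (y - x) :=
  ae_restrict_of_ae ((measurePreserving_sub_right volume x).quasiMeasurePreserving.ae h)

theorem ae_prod_sub_of_ae {P : 𝔼 → Prop} (h : ∀ᵐ ξ, P ξ) (Ω : Set 𝔼) :
    ∀ᵐ p ∂((volume : Measure (𝔼 × 𝔼)).restrict (Ω ×ˢ Ω)), P (p.2 - p.1) := by
  refine ae_restrict_of_ae ?_
  have h1 := (quasiMeasurePreserving_sub_of_right_invariant (volume : Measure 𝔼) volume).ae h
  exact (Measure.measurePreserving_swap (μ := (volume : Measure 𝔼))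
    (ν := volume)).quasiMeasurePreserving.ae h1

theorem ae_prod_of_ae {P : 𝔼 → Prop} {Ω : Set 𝔼} (h : ∀ᵐ x ∂(volume.restrict Ω), P x) :
    ∀ᵐ p ∂((volume : Measure (𝔼 × 𝔼)).restrict (Ω ×ˢ Ω)), P p.1 ∧ P p.2 := by
  rw [← volume_restrict_prod]
  exact (Measure.quasiMeasurePreserving_fst.ae h).and (Measure.quasiMeasurePreserving_snd.ae h)

/-- Tonelli's theorem needs the Borel representative `R`. For every `x`, the exceptional null set of
`ξ` translates to a null set of `y`, so the inner integrals agree. -/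
theorem bondForm_eq_bondEnergy {Ω : Set 𝔼} {ρ R : 𝔼 → ℝ} (hR : Measurable R)
    (h : ∀ᵐ ξ, ρ ξ = R ξ) (u : L2Field Ω) : bondForm ρ u = bondEnergy Ω R u := by
  have hm := measurable_bondDensity hR (Lp.stronglyMeasurable u).measurable
  rw [bondEnergy, ← volume_restrict_prod, lintegral_prod _ hm.aemeasurable, bondForm]
  refine lintegral_congr fun x => lintegral_congr_ae ?_
  filter_upwards [ae_sub_of_ae h x Ω] with y hy
  rw [hy, bondQuot]

theorem lintegral_lintegral_eq_storedEnergy {Ω : Set 𝔼} {w W : 𝔼 → ℝ → ℝ}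
    (hW : Measurable (Function.uncurry W)) (h : ∀ᵐ ξ, ∀ s ≥ -1, w ξ s = W ξ s) (ε : ℝ)
    (u : L2Field Ω) :
    ENNReal.ofReal (ε ^ 2)⁻¹ *
      ∫⁻ x in Ω, ∫⁻ y in Ω,
        ENNReal.ofReal (w (y - x) (‖diffQuot id y x + ε • diffQuot u y x‖ - 1))
      = storedEnergy Ω W ε u := by
  have hm := measurable_storedDensity hW (Lp.stronglyMeasurable u).measurable ε
  rw [storedEnergy, ← volume_restrict_prod, lintegral_prod _ hm.aemeasurable,
    ← lintegral_const_mul' _ _ ENNReal.ofReal_ne_top]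
  refine lintegral_congr fun x => ?_
  rw [← lintegral_const_mul' _ _ ENNReal.ofReal_ne_top]
  refine lintegral_congr_ae ?_
  filter_upwards [ae_sub_of_ae h x Ω] with y hy
  rw [hy _ (by linarith [norm_nonneg (diffQuot id y x + ε • diffQuot u y x)])]

theorem bondEnergy_congr {Ω : Set 𝔼} {R : 𝔼 → ℝ} {f g : 𝔼 → 𝔼}
    (h : f =ᵐ[volume.restrict Ω] g) : bondEnergy Ω R f = bondEnergy Ω R g := by
  refine lintegral_congr_ae ?_
  filter_upwards [ae_prod_of_ae h] with p hp
  simp only [bondQuot, diffQuot, hp.1, hp.2]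

theorem storedEnergy_congr {Ω : Set 𝔼} {W : 𝔼 → ℝ → ℝ} {ε : ℝ} {f g : 𝔼 → 𝔼}
    (h : f =ᵐ[volume.restrict Ω] g) : storedEnergy Ω W ε f = storedEnergy Ω W ε g := by
  refine lintegral_congr_ae ?_
  filter_upwards [ae_prod_of_ae h] with p hp
  simp only [diffQuot, hp.1, hp.2]

/-- Parallelogram identity for the quadratic energy. -/
theorem bondEnergy_half_add_add_half_sub {Ω : Set 𝔼} {R : 𝔼 → ℝ} (hR : Measurable R)
    (hR0 : ∀ ξ, 0 ≤ R ξ) {f g : 𝔼 → 𝔼} (hf : Measurable f) (hg : Measurable g) :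
    bondEnergy Ω R ((2⁻¹ : ℝ) • (f + g)) + bondEnergy Ω R ((2⁻¹ : ℝ) • (f - g))
      = 2⁻¹ * bondEnergy Ω R f + 2⁻¹ * bondEnergy Ω R g := by
  simp only [bondEnergy]
  rw [← lintegral_const_mul _ (measurable_bondDensity hR hf),
    ← lintegral_const_mul _ (measurable_bondDensity hR hg),
    ← lintegral_add_left (measurable_bondDensity hR ((hf.add hg).const_smul _)),
    ← lintegral_add_left ((measurable_bondDensity hR hf).const_mul _)]
  refine lintegral_congr fun p => ?_
  have h0 := hR0 (p.2 - p.1)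
  rw [show (2⁻¹ : ℝ≥0∞) = ENNReal.ofReal 2⁻¹ by
      rw [ENNReal.ofReal_inv_of_pos two_pos, ENNReal.ofReal_ofNat],
    ← ENNReal.ofReal_mul (by norm_num), ← ENNReal.ofReal_mul (by norm_num),
    ← ENNReal.ofReal_add (by positivity) (by positivity),
    ← ENNReal.ofReal_add (by positivity) (by positivity)]
  simp only [bondQuot_smul, bondQuot_add, bondQuot_sub]
  congr 1
  ring

/-- Young's inequality for the seminorm; the 4 undoes the factor `2⁻¹` on the difference, kept to
match the parallelogram identity. -/
theorem bondEnergy_le_add {Ω : Set 𝔼} {R : 𝔼 → ℝ} (hR : Measurable R) (hR0 : ∀ ξ, 0 ≤ R ξ)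
    {f g : 𝔼 → 𝔼} (hf : Measurable f) (hg : Measurable g) {t : ℝ} (ht : 0 < t) :
    bondEnergy Ω R g ≤ ENNReal.ofReal (1 + t) * bondEnergy Ω R f
      + ENNReal.ofReal (4 * (1 + t⁻¹)) * bondEnergy Ω R ((2⁻¹ : ℝ) • (f - g)) := by
  simp only [bondEnergy]
  rw [← lintegral_const_mul _ (measurable_bondDensity hR hf),
    ← lintegral_const_mul _ (measurable_bondDensity hR ((hf.sub hg).const_smul _)),
    ← lintegral_add_left ((measurable_bondDensity hR hf).const_mul _)]
  refine lintegral_mono fun p => ?_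
  have h0 := hR0 (p.2 - p.1)
  rw [← ENNReal.ofReal_mul (by positivity), ← ENNReal.ofReal_mul (by positivity),
    ← ENNReal.ofReal_add (by positivity) (by positivity)]
  apply ENNReal.ofReal_le_ofReal
  simp only [bondQuot_smul, bondQuot_sub]
  set a := bondQuot f p
  set b := bondQuot g p
  have key : b ^ 2 ≤ (1 + t) * a ^ 2 + (1 + t⁻¹) * (a - b) ^ 2 := by
    have h1 : (1 + t) * a ^ 2 + (1 + t⁻¹) * (a - b) ^ 2 - b ^ 2
        = t⁻¹ * (t * a + (a - b)) ^ 2 := by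
      field_simp
      ring
    have : 0 ≤ t⁻¹ * (t * a + (a - b)) ^ 2 := by positivity
    linarith
  calc R (p.2 - p.1) * b ^ 2
      ≤ R (p.2 - p.1) * ((1 + t) * a ^ 2 + (1 + t⁻¹) * (a - b) ^ 2) :=
        mul_le_mul_of_nonneg_left key h0
    _ = _ := by ring

theorem bondEnergy_sum_le {Ω : Set 𝔼} {R : 𝔼 → ℝ} (hR : Measurable R) (hR0 : ∀ ξ, 0 ≤ R ξ)
    {ι : Type*} (s : Finset ι) {f : ι → 𝔼 → 𝔼} (hf : ∀ i, Measurable (f i)) :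
    bondEnergy Ω R (∑ i ∈ s, f i) ≤ s.card * ∑ i ∈ s, bondEnergy Ω R (f i) := by
  simp only [bondEnergy]
  rw [← lintegral_finsetSum _ fun i _ => measurable_bondDensity hR (hf i),
    ← lintegral_const_mul' _ _ (ENNReal.natCast_ne_top _)]
  refine lintegral_mono fun p => ?_
  have h0 := hR0 (p.2 - p.1)
  rw [← ENNReal.ofReal_sum_of_nonneg fun i _ => by positivity, ← ENNReal.ofReal_natCast,
    ← ENNReal.ofReal_mul (by positivity), bondQuot_sum]
  apply ENNReal.ofReal_le_ofReal
  rw [← Finset.mul_sum, mul_left_comm]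
  exact mul_le_mul_of_nonneg_left sq_sum_le_card_mul_sum_sq h0

theorem tendsto_diffQuot {f : ℕ → 𝔼 → 𝔼} {g : 𝔼 → 𝔼} {y x : 𝔼}
    (hy : Tendsto (fun n => f n y) atTop (𝓝 (g y))) (hx : Tendsto (fun n => f n x) atTop (𝓝 (g x))) :
    Tendsto (fun n => diffQuot (f n) y x) atTop (𝓝 (diffQuot g y x)) :=
  (hy.sub hx).const_smul _

/-- Fatou's lemma. -/
theorem bondEnergy_le_liminf {Ω : Set 𝔼} {R : 𝔼 → ℝ} (hR : Measurable R)
    {f : ℕ → 𝔼 → 𝔼} {g : 𝔼 → 𝔼} (hf : ∀ n, Measurable (f n))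
    (h : ∀ᵐ x ∂(volume.restrict Ω), Tendsto (fun n => f n x) atTop (𝓝 (g x))) :
    bondEnergy Ω R g ≤ liminf (fun n => bondEnergy Ω R (f n)) atTop := by
  refine le_trans (le_of_eq ?_) (lintegral_liminf_le fun n => measurable_bondDensity hR (hf n))
  refine lintegral_congr_ae ?_
  filter_upwards [ae_prod_of_ae h] with p hp
  refine (Tendsto.liminf_eq ?_).symm
  refine ENNReal.tendsto_ofReal (Tendsto.const_mul _ (Tendsto.pow ?_ 2))
  exact (tendsto_diffQuot hp.2 hp.1).inner tendsto_const_nhds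

/-- Rationalizing gives `|a + εc| - 1 = (2ε a·c + ε²|c|²) / (|a + εc| + 1)`. -/
theorem tendsto_norm_add_smul_sub_one_div {F : Type*} [NormedAddCommGroup F] [InnerProductSpace ℝ F]
    {a b : F} (ha : ‖a‖ = 1) {ε : ℕ → ℝ} {c : ℕ → F} (hε0 : ∀ n, 0 < ε n)
    (hε : Tendsto ε atTop (𝓝 0)) (hc : Tendsto c atTop (𝓝 b)) :
    Tendsto (fun n => (‖a + ε n • c n‖ - 1) / ε n) atTop (𝓝 (inner ℝ b a)) := by
  have h1 : Tendsto (fun n => (2 * inner ℝ a (c n) + ε n * ‖c n‖ ^ 2) / (‖a + ε n • c n‖ + 1)) atTop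
      (𝓝 ((2 * inner ℝ a b + 0 * ‖b‖ ^ 2) / (‖a + (0 : ℝ) • b‖ + 1))) := by
    refine Tendsto.div (((tendsto_const_nhds.inner hc).const_mul 2).add (hε.mul (hc.norm.pow 2)))
      ((tendsto_const_nhds.add (hε.smul hc)).norm.add_const 1) ?_
    positivity
  convert h1 using 2 with n
  · have hpos : 0 < ‖a + ε n • c n‖ + 1 := by positivity
    rw [div_eq_div_iff (hε0 n).ne' hpos.ne']
    have : ‖a + ε n • c n‖ ^ 2 = 1 + 2 * (ε n * inner ℝ a (c n)) + ε n ^ 2 * ‖c n‖ ^ 2 := by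
      rw [norm_add_sq_real, ha, real_inner_smul_right, norm_smul, mul_pow, Real.norm_eq_abs, sq_abs,
        one_pow]
    linear_combination this
  · rw [zero_smul, add_zero, ha, real_inner_comm]
    ring

theorem tendsto_potential_div_sq {φ : ℝ → ℝ} {r c : ℝ}
    (hφ : (fun s => φ s - r / 2 * s ^ 2) =o[𝓝 0] fun s => s ^ 2) {ε s : ℕ → ℝ}
    (hε0 : ∀ n, 0 < ε n) (hε : Tendsto ε atTop (𝓝 0))
    (hs : Tendsto (fun n => s n / ε n) atTop (𝓝 c)) :
    Tendsto (fun n => (ε n ^ 2)⁻¹ * φ (s n)) atTop (𝓝 (2⁻¹ * (r * c ^ 2))) := by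
  have hsO : s =O[atTop] ε := by
    refine Asymptotics.isBigO_of_div_tendsto_nhds (Eventually.of_forall fun n h => ?_) c hs
    exact absurd h (hε0 n).ne'
  have hs0 : Tendsto s atTop (𝓝 0) := hsO.trans_tendsto hε
  have h1 := ((hφ.comp_tendsto hs0).trans_isBigO (hsO.pow 2)).tendsto_div_nhds_zero
  have h2 := h1.add ((hs.pow 2).const_mul (r / 2))
  rw [zero_add, show r / 2 * c ^ 2 = 2⁻¹ * (r * c ^ 2) by ring] at h2
  refine h2.congr fun n => ?_
  have := (hε0 n).ne'
  simp only [Function.comp]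
  field_simp
  ring

/-- Pointwise convergence of the stored energy densities. -/
theorem tendsto_storedDensity {W : 𝔼 → ℝ → ℝ} {R : 𝔼 → ℝ}
    (hlim : ∀ ξ, (fun s => W ξ s - R ξ / 2 * s ^ 2) =o[𝓝 0] fun s => s ^ 2) {ε : ℕ → ℝ}
    (hε0 : ∀ n, 0 < ε n) (hε : Tendsto ε atTop (𝓝 0)) {f : ℕ → 𝔼 → 𝔼} {g : 𝔼 → 𝔼} {p : 𝔼 × 𝔼}
    (hp : p.2 - p.1 ≠ 0) (h1 : Tendsto (fun n => f n p.1) atTop (𝓝 (g p.1)))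
    (h2 : Tendsto (fun n => f n p.2) atTop (𝓝 (g p.2))) :
    Tendsto (fun n => ENNReal.ofReal (ε n ^ 2)⁻¹ * ENNReal.ofReal
      (W (p.2 - p.1) (‖diffQuot id p.2 p.1 + ε n • diffQuot (f n) p.2 p.1‖ - 1))) atTop
      (𝓝 (2⁻¹ * ENNReal.ofReal (R (p.2 - p.1) * bondQuot g p ^ 2))) := by
  have h := ENNReal.tendsto_ofReal (tendsto_potential_div_sq (hlim (p.2 - p.1)) hε0 hε
    (tendsto_norm_add_smul_sub_one_div (norm_diffQuot_id hp) hε0 hε (tendsto_diffQuot h2 h1)))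
  rw [ENNReal.ofReal_mul (by norm_num), ENNReal.ofReal_inv_of_pos two_pos,
    ENNReal.ofReal_ofNat] at h
  refine h.congr fun n => ?_
  rw [ENNReal.ofReal_mul (by positivity)]

/-- This is where `d ≥ 1` enters: on the diagonal the strain is `-1` instead of small, and the
diagonal must be null. -/
theorem ae_prod_sub_ne_zero [Nontrivial 𝔼] (Ω : Set 𝔼) :
    ∀ᵐ p ∂((volume : Measure (𝔼 × 𝔼)).restrict (Ω ×ˢ Ω)), p.2 - p.1 ≠ 0 :=
  ae_prod_sub_of_ae (P := fun ξ => ξ ≠ 0) (by simp [ae_iff]) Ω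

theorem bondEnergy_le_liminf_storedEnergy [Nontrivial 𝔼] {Ω : Set 𝔼} {W : 𝔼 → ℝ → ℝ} {R : 𝔼 → ℝ}
    (hW : Measurable (Function.uncurry W)) (hR : Measurable R)
    (hlim : ∀ ξ, (fun s => W ξ s - R ξ / 2 * s ^ 2) =o[𝓝 0] fun s => s ^ 2) {ε : ℕ → ℝ}
    (hε0 : ∀ n, 0 < ε n) (hε : Tendsto ε atTop (𝓝 0)) {f : ℕ → 𝔼 → 𝔼} {g : 𝔼 → 𝔼}
    (hf : ∀ n, Measurable (f n)) (hg : Measurable g)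
    (h : ∀ᵐ x ∂(volume.restrict Ω), Tendsto (fun n => f n x) atTop (𝓝 (g x))) :
    2⁻¹ * bondEnergy Ω R g ≤ liminf (fun n => storedEnergy Ω W (ε n) (f n)) atTop := by
  rw [bondEnergy, ← lintegral_const_mul _ (measurable_bondDensity hR hg)]
  refine le_trans (le_of_eq ?_)
    (lintegral_liminf_le fun n => measurable_storedDensity hW (hf n) (ε n))
  refine lintegral_congr_ae ?_
  filter_upwards [ae_prod_of_ae h, ae_prod_sub_ne_zero Ω] with p hp hp0
  exact (tendsto_storedDensity hlim hε0 hε hp0 hp.1 hp.2).liminf_eq.symm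

end BondEnergy

/-! ### Near-minimizers of a quadratic functional -/

/-- Midpoint-convex decreasing families with a quadratic functional that is bounded along them have
selections whose pairwise differences have uniformly small energy. -/
theorem exists_seq_forall_dif_le {V : Type*} {K : ℕ → Set V} (hK : Antitone K) {Q : V → ℝ≥0∞}
    {mid dif : V → V → V} (hmid : ∀ n, ∀ f ∈ K n, ∀ g ∈ K n, mid f g ∈ K n)
    (hpar : ∀ f ∈ K 0, ∀ g ∈ K 0, Q (mid f g) + Q (dif f g) = 2⁻¹ * Q f + 2⁻¹ * Q g)
    {C : ℝ≥0∞} (hC : C ≠ ∞) (h : ∀ n, ∃ f ∈ K n, Q f ≤ C) {η : ℝ≥0∞} (hη : η ≠ 0) :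
    ∃ y : ℕ → V, (∀ n, y n ∈ K n) ∧ ∀ n m, Q (dif (y n) (y m)) ≤ η := by
  -- The infima increase to `S ≤ C`. From some `N` on they are at least `S - η/2`; fields with `Q <
  -- S + η/2` have midpoints in `K N`, where `Q ≥ S - η/2`, so the parallelogram identity leaves at
  -- most `η` for the difference.
  set S : ℝ≥0∞ := ⨆ n, ⨅ f ∈ K n, Q f with hS
  have hSC : S ≤ C := iSup_le fun n => by
    obtain ⟨f, hf, hfC⟩ := h n
    exact (iInf₂_le f hf).trans hfC
  have hST : S ≠ ∞ := ne_top_of_le_ne_top hC hSC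
  have hη' : η / 2 ≠ 0 := by simpa using hη
  obtain ⟨N, hN⟩ : ∃ N, S ≤ (⨅ f ∈ K N, Q f) + η / 2 := by
    by_contra! hcon
    have h1 : S + η / 2 ≤ S := by
      conv_lhs => rw [hS, ENNReal.iSup_add]
      exact iSup_le fun n => (hcon n).le
    exact absurd h1 (not_le.2 (ENNReal.lt_add_right hST hη'))
  have hex : ∀ n, ∃ f ∈ K (N + n), Q f < S + η / 2 := by
    intro n
    have h1 : (⨅ f ∈ K (N + n), Q f) < S + η / 2 :=
      (le_iSup (fun n => ⨅ f ∈ K n, Q f) (N + n)).trans_lt (ENNReal.lt_add_right hST hη')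
    simpa [iInf_lt_iff] using h1
  choose y hyK hyQ using hex
  refine ⟨y, fun n => hK (Nat.le_add_left n N) (hyK n), fun n m => ?_⟩
  have hn := hK (Nat.le_add_right N n) (hyK n)
  have hm := hK (Nat.le_add_right N m) (hyK m)
  have hp := hpar _ (hK (Nat.zero_le N) hn) _ (hK (Nat.zero_le N) hm)
  have hmidle : S ≤ Q (mid (y n) (y m)) + η / 2 :=
    hN.trans (by gcongr; exact iInf₂_le _ (hmid N _ hn _ hm))
  have hsum : 2⁻¹ * Q (y n) + 2⁻¹ * Q (y m) ≤ S + η / 2 := by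
    calc 2⁻¹ * Q (y n) + 2⁻¹ * Q (y m)
        ≤ 2⁻¹ * (S + η / 2) + 2⁻¹ * (S + η / 2) := by
          gcongr
          exacts [(hyQ n).le, (hyQ m).le]
      _ = S + η / 2 := by rw [← add_mul, ENNReal.inv_two_add_inv_two, one_mul]
  by_cases hηT : η = ∞
  · simp [hηT]
  -- Finiteness allows cancelling the midpoint energy in `ℝ≥0∞`.
  have hfin : Q (mid (y n) (y m)) ≠ ∞ := by
    refine ne_top_of_le_ne_top ?_ (le_self_add.trans (hp.le.trans hsum))
    exact ENNReal.add_ne_top.2 ⟨hST, ENNReal.div_ne_top hηT two_ne_zero⟩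
  refine (ENNReal.add_le_add_iff_left hfin).1 ?_
  calc _ ≤ S + η / 2 := hp.le.trans hsum
    _ ≤ Q (mid (y n) (y m)) + η / 2 + η / 2 := by gcongr
    _ = _ := by rw [add_assoc, ENNReal.add_halves]

/-! ### Lipschitz fields and almost optimal approximation -/

section BondEnergy

variable {d : ℕ}

local notation "𝔼" => EuclideanSpace ℝ (Fin d)

/-- Differences of points of `Ω` stay in a fixed ball, over which the locally integrable `R` has
finite integral `M`; this is Young's convolution bound. It serves the dominating function on
Lipschitz fields and the cost of cutoffs. -/
theorem exists_lintegral_kernel_mul_le {Ω : Set 𝔼} (hΩ : MeasurableSet Ω)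
    (hΩb : Bornology.IsBounded Ω) {R : 𝔼 → ℝ} (hRm : Measurable R)
    (hR : LocallyIntegrable R volume) :
    ∃ M : ℝ≥0∞, M ≠ ∞ ∧ ∀ g : 𝔼 → ℝ≥0∞, Measurable g →
      ∫⁻ p in Ω ×ˢ Ω, ENNReal.ofReal (R (p.2 - p.1)) * g p.1 ≤ M * ∫⁻ x in Ω, g x ∧
      ∫⁻ p in Ω ×ˢ Ω, ENNReal.ofReal (R (p.2 - p.1)) * g p.2 ≤ M * ∫⁻ x in Ω, g x := by
  obtain ⟨r, hr⟩ := hΩb.subset_closedBall 0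
  have hball : ∀ x ∈ Ω, ∀ y ∈ Ω, y - x ∈ Metric.closedBall (0 : 𝔼) (2 * r) := by
    intro x hx y hy
    have h1 := hr hx
    have h2 := hr hy
    rw [mem_closedBall_zero_iff] at *
    linarith [norm_sub_le y x]
  set B := (Metric.closedBall (0 : 𝔼) (2 * r)).indicator fun ξ => ENNReal.ofReal (R ξ) with hB
  have hBm : Measurable B := hRm.ennreal_ofReal.indicator measurableSet_closedBall
  have hle : ∀ x ∈ Ω, ∀ y ∈ Ω, ENNReal.ofReal (R (y - x)) ≤ B (y - x) := fun x hx y hy => by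
    rw [hB, indicator_of_mem (hball x hx y hy)]
  refine ⟨∫⁻ ξ, B ξ, ?_, fun g hg => ⟨?_, ?_⟩⟩
  · rw [hB, lintegral_indicator measurableSet_closedBall]
    have hint := hR.integrableOn_isCompact (isCompact_closedBall (0 : 𝔼) (2 * r))
    exact hint.lintegral_lt_top.ne
  · rw [← volume_restrict_prod, lintegral_prod _ (by fun_prop), ← lintegral_const_mul _ hg]
    refine setLIntegral_mono' hΩ fun x hx => ?_
    dsimp only
    rw [lintegral_mul_const _ (by fun_prop)]
    refine mul_le_mul_left ?_ _
    calc ∫⁻ y in Ω, ENNReal.ofReal (R (y - x)) ≤ ∫⁻ y in Ω, B (y - x) :=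
          setLIntegral_mono' hΩ fun y hy => hle x hx y hy
      _ ≤ ∫⁻ y, B (y - x) := setLIntegral_le_lintegral _ _
      _ = _ := lintegral_sub_right_eq_self _ _
  · rw [← volume_restrict_prod, lintegral_prod_symm _ (by fun_prop), ← lintegral_const_mul _ hg]
    refine setLIntegral_mono' hΩ fun y hy => ?_
    dsimp only
    rw [lintegral_mul_const _ (by fun_prop)]
    refine mul_le_mul_left ?_ _
    calc ∫⁻ x in Ω, ENNReal.ofReal (R (y - x)) ≤ ∫⁻ x in Ω, B (y - x) :=
          setLIntegral_mono' hΩ fun x hx => hle x hx y hy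
      _ ≤ ∫⁻ x, B (y - x) := setLIntegral_le_lintegral _ _
      _ = _ := lintegral_sub_left_eq_self _ _

/-- On Lipschitz fields the stored energies converge to the quadratic energy. -/
theorem tendsto_storedEnergy_of_lipschitz [Nontrivial 𝔼] {Ω : Set 𝔼} (hΩ : MeasurableSet Ω)
    (hΩb : Bornology.IsBounded Ω) {W : 𝔼 → ℝ → ℝ} {R : 𝔼 → ℝ} {C δ₀ : ℝ}
    (hW : Measurable (Function.uncurry W)) (hRm : Measurable R) (hR : LocallyIntegrable R volume)
    (hR0 : ∀ ξ, 0 ≤ R ξ) (hC : 0 ≤ C) (hδ₀ : 0 < δ₀)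
    (hle : ∀ ξ s, |s| < δ₀ → W ξ s ≤ C * R ξ * s ^ 2)
    (hlim : ∀ ξ, (fun s => W ξ s - R ξ / 2 * s ^ 2) =o[𝓝 0] fun s => s ^ 2) {ε : ℕ → ℝ}
    (hε0 : ∀ n, 0 < ε n) (hε : Tendsto ε atTop (𝓝 0)) {f : 𝔼 → 𝔼} {L : NNReal}
    (hf : LipschitzWith L f) :
    Tendsto (fun n => storedEnergy Ω W (ε n) f) atTop (𝓝 (2⁻¹ * bondEnergy Ω R f)) := by
  have hfm := hf.continuous.measurable
  rw [bondEnergy, ← lintegral_const_mul _ (measurable_bondDensity hRm hfm)]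
  refine tendsto_lintegral_filter_of_dominated_convergence
    (fun p => ENNReal.ofReal (R (p.2 - p.1)) * ENNReal.ofReal (C * L ^ 2))
    (Eventually.of_forall fun n => measurable_storedDensity hW hfm (ε n)) ?_ ?_ ?_
  -- The strain of an `L`-Lipschitz field is at most `ε L`, so eventually the quadratic bound
  -- applies at every pair off the diagonal.
  · have hsmall : ∀ᶠ n in atTop, ε n * L < δ₀ := by
      have := hε.mul_const (L : ℝ)
      rw [zero_mul] at this
      exact this.eventually_lt_const hδ₀
    filter_upwards [hsmall] with n hn
    filter_upwards [ae_prod_sub_ne_zero Ω] with p hp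
    have hD : ‖diffQuot f p.2 p.1‖ ≤ L := by
      rw [diffQuot, norm_smul, norm_inv, norm_norm, inv_mul_le_iff₀ (norm_pos_iff.2 hp), mul_comm]
      exact hf.norm_sub_le _ _
    have hs : |‖diffQuot id p.2 p.1 + ε n • diffQuot f p.2 p.1‖ - 1| ≤ ε n * L := by
      have h1 := abs_norm_sub_norm_le (diffQuot id p.2 p.1 + ε n • diffQuot f p.2 p.1)
        (diffQuot id p.2 p.1)
      rw [norm_diffQuot_id hp, add_sub_cancel_left, norm_smul, Real.norm_of_nonneg (hε0 n).le] at h1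
      exact h1.trans (mul_le_mul_of_nonneg_left hD (hε0 n).le)
    have hb := hle (p.2 - p.1) _ (hs.trans_lt hn)
    have h0 := hR0 (p.2 - p.1)
    have hεn := hε0 n
    rw [← ENNReal.ofReal_mul (by positivity), ← ENNReal.ofReal_mul h0]
    refine ENNReal.ofReal_le_ofReal ?_
    rw [inv_mul_le_iff₀ (by positivity)]
    refine hb.trans ?_
    calc C * R (p.2 - p.1) * (‖diffQuot id p.2 p.1 + ε n • diffQuot f p.2 p.1‖ - 1) ^ 2
        ≤ C * R (p.2 - p.1) * (ε n * L) ^ 2 := by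
          refine mul_le_mul_of_nonneg_left ?_ (by positivity)
          rw [← sq_abs]
          gcongr
      _ = _ := by ring
  · obtain ⟨M, hM, h⟩ := exists_lintegral_kernel_mul_le hΩ hΩb hRm hR
    refine ne_top_of_le_ne_top ?_ (h (fun _ => ENNReal.ofReal (C * L ^ 2)) measurable_const).1
    rw [setLIntegral_const]
    exact ENNReal.mul_ne_top hM (ENNReal.mul_ne_top ENNReal.ofReal_ne_top hΩb.measure_lt_top.ne)
  · filter_upwards [ae_prod_sub_ne_zero Ω] with p hp
    exact tendsto_storedDensity hlim hε0 hε hp tendsto_const_nhds tendsto_const_nhds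

/-- Approximation with bounded energies improves to approximation with almost optimal energies. -/
theorem exists_lipschitz_bondEnergy_le_add {Ω : Set 𝔼} {R : 𝔼 → ℝ} (hRm : Measurable R)
    (hR0 : ∀ ξ, 0 ≤ R ξ) {u : 𝔼 → 𝔼} (hu : Measurable u) (hE : bondEnergy Ω R u ≠ ∞)
    {C : ℝ≥0∞} (hC : C ≠ ∞)
    (h : ∀ δ > (0 : ℝ), ∃ f : 𝔼 → 𝔼, (∃ L : NNReal, LipschitzWith L f) ∧
      eLpNorm (f - u) 2 (volume.restrict Ω) ≤ ENNReal.ofReal δ ∧ bondEnergy Ω R f ≤ C)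
    {δ : ℝ} (hδ : 0 < δ) :
    ∃ f : 𝔼 → 𝔼, (∃ L : NNReal, LipschitzWith L f) ∧
      eLpNorm (f - u) 2 (volume.restrict Ω) ≤ ENNReal.ofReal δ ∧
      bondEnergy Ω R f ≤ bondEnergy Ω R u + ENNReal.ofReal δ := by
  set K : ℕ → Set (𝔼 → 𝔼) := fun n => {f | (∃ L : NNReal, LipschitzWith L f) ∧
      eLpNorm (f - u) 2 (volume.restrict Ω) ≤ ENNReal.ofReal (δ / (n + 1))} with hKdef
  have hmeas : ∀ {n f}, f ∈ K n → Measurable f := fun hf => by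
    obtain ⟨⟨L, hL⟩, -⟩ := hf
    exact hL.continuous.measurable
  have hK : Antitone K := fun n m hnm f hf => by
    refine ⟨hf.1, hf.2.trans (ENNReal.ofReal_le_ofReal ?_)⟩
    gcongr
  have hmid : ∀ n, ∀ f ∈ K n, ∀ g ∈ K n, (2⁻¹ : ℝ) • (f + g) ∈ K n := by
    rintro n f hf g hg
    have hfm := hmeas hf
    have hgm := hmeas hg
    obtain ⟨⟨L, hL⟩, hfu⟩ := hf
    obtain ⟨⟨L', hL'⟩, hgu⟩ := hg
    refine ⟨⟨_, (lipschitzWith_smul (2⁻¹ : ℝ)).comp (hL.add hL')⟩, ?_⟩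
    rw [show (2⁻¹ : ℝ) • (f + g) - u = (2⁻¹ : ℝ) • (f - u) + (2⁻¹ : ℝ) • (g - u) by
      module]
    refine (eLpNorm_add_le ((hfm.sub hu).const_smul _).aestronglyMeasurable
      ((hgm.sub hu).const_smul _).aestronglyMeasurable one_le_two).trans ?_
    rw [eLpNorm_const_smul, eLpNorm_const_smul, ← mul_add]
    have h2 : ‖(2⁻¹ : ℝ)‖ₑ = 2⁻¹ := by
      rw [Real.enorm_of_nonneg (by norm_num), ENNReal.ofReal_inv_of_pos two_pos,
        ENNReal.ofReal_ofNat]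
    rw [h2, ENNReal.inv_mul_le_iff two_ne_zero ENNReal.ofNat_ne_top, two_mul]
    exact add_le_add hfu hgu
  set E := (bondEnergy Ω R u).toReal with hEdef
  have hE0 : 0 ≤ E := ENNReal.toReal_nonneg
  -- Chosen with `η` so that in `(1 + t) E + 4 (1 + t⁻¹) η` both excesses over `E` are at most `δ /
  -- 2`.
  set t := δ / 2 / (E + 1) with ht
  have ht0 : 0 < t := by positivity
  have htE : t * E ≤ δ / 2 := by
    rw [ht, div_mul_eq_mul_div, div_le_iff₀ (by positivity)]
    nlinarith
  set η := δ / 2 / (4 * (1 + t⁻¹)) with hη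
  have hη0 : 0 < η := by positivity
  obtain ⟨y, hy, hyQ⟩ := exists_seq_forall_dif_le (Q := bondEnergy Ω R)
    (dif := fun f g => (2⁻¹ : ℝ) • (f - g)) hK hmid
    (fun f hf g hg => bondEnergy_half_add_add_half_sub hRm hR0 (hmeas hf) (hmeas hg)) hC
    (fun n => by
      obtain ⟨f, hf, hfu, hfC⟩ := h (δ / (n + 1)) (by positivity)
      exact ⟨f, ⟨hf, hfu⟩, hfC⟩) (η := ENNReal.ofReal η) (by simpa using hη0)
  have hconv : Tendsto (fun n => eLpNorm (y n - u) 2 (volume.restrict Ω)) atTop (𝓝 0) := by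
    refine tendsto_of_tendsto_of_tendsto_of_le_of_le tendsto_const_nhds ?_ (fun n => zero_le)
      fun n => (hy n).2
    rw [← ENNReal.ofReal_zero]
    refine ENNReal.tendsto_ofReal ?_
    have := (tendsto_one_div_add_atTop_nhds_zero_nat (𝕜 := ℝ)).const_mul δ
    simpa [div_eq_mul_inv] using this
  obtain ⟨φ, -, hφ⟩ := (tendstoInMeasure_of_tendsto_eLpNorm two_ne_zero
    (fun n => (hmeas (hy n)).aestronglyMeasurable) hu.aestronglyMeasurable
    hconv).exists_seq_tendsto_ae
  -- Lower semicontinuity lets `y n` be replaced by its limit `u` in the bound on pairwise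
  -- differences.
  have hlow : bondEnergy Ω R ((2⁻¹ : ℝ) • (u - y 0)) ≤ ENNReal.ofReal η := by
    refine (bondEnergy_le_liminf (f := fun n => (2⁻¹ : ℝ) • (y (φ n) - y 0)) hRm
      (fun n => ((hmeas (hy _)).sub (hmeas (hy 0))).const_smul _) ?_).trans ?_
    · filter_upwards [hφ] with x hx
      exact (hx.sub (tendsto_const_nhds (x := y 0 x))).const_smul (2⁻¹ : ℝ)
    · refine (liminf_le_liminf (Eventually.of_forall fun n => hyQ (φ n) 0)).trans_eq ?_
      exact tendsto_const_nhds.liminf_eq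
  refine ⟨y 0, (hy 0).1, by simpa using (hy 0).2, ?_⟩
  refine (bondEnergy_le_add hRm hR0 hu (hmeas (hy 0)) ht0).trans ?_
  rw [← ENNReal.ofReal_toReal hE, ← hEdef]
  refine (add_le_add_right (mul_le_mul_right hlow _) _).trans ?_
  rw [← ENNReal.ofReal_mul (by positivity), ← ENNReal.ofReal_mul (by positivity),
    ← ENNReal.ofReal_add (by positivity) (by positivity), ← ENNReal.ofReal_add hE0 hδ.le]
  refine ENNReal.ofReal_le_ofReal ?_
  rw [hη, mul_div_cancel₀ _ (by positivity)]
  linarith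

end BondEnergy

/-! ### Jensen's inequality and translations in `L²` -/

theorem eLpNorm_two_sq {α F : Type*} [MeasurableSpace α] {μ : Measure α} [NormedAddCommGroup F]
    (f : α → F) : eLpNorm f 2 μ ^ 2 = ∫⁻ x, ‖f x‖ₑ ^ 2 ∂μ := by
  have h := eLpNorm_nnreal_pow_eq_lintegral (f := f) (μ := μ) (p := 2) two_ne_zero
  simpa using h

theorem sq_lintegral_le_lintegral_sq {α : Type*} [MeasurableSpace α] {μ : Measure α}
    [IsProbabilityMeasure μ] {f : α → ℝ≥0∞} (hf : AEMeasurable f μ) :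
    (∫⁻ x, f x ∂μ) ^ 2 ≤ ∫⁻ x, f x ^ 2 ∂μ := by
  have h := ENNReal.lintegral_mul_le_Lp_mul_Lq μ Real.HolderConjugate.two_two hf
    (aemeasurable_const (b := (1 : ℝ≥0∞)))
  simp only [Pi.mul_apply, mul_one, ENNReal.one_rpow, lintegral_const, measure_univ] at h
  calc (∫⁻ x, f x ∂μ) ^ 2 ≤ ((∫⁻ x, f x ^ (2 : ℝ) ∂μ) ^ (1 / 2 : ℝ)) ^ 2 := by gcongr
    _ = ∫⁻ x, f x ^ 2 ∂μ := by
      rw [← ENNReal.rpow_natCast, ← ENNReal.rpow_mul]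
      simp

/-- Jensen's inequality for the square, with `η` as the density of a probability measure. -/
theorem enorm_integral_smul_sq_le {α F : Type*} [MeasurableSpace α] {μ : Measure α} [SFinite μ]
    [NormedAddCommGroup F] [NormedSpace ℝ F] {η : α → ℝ} (hη : Measurable η) (hη0 : ∀ z, 0 ≤ η z)
    (hη1 : ∫⁻ z, ENNReal.ofReal (η z) ∂μ = 1) {g : α → F} (hg : AEStronglyMeasurable g μ) :
    ‖∫ z, η z • g z ∂μ‖ₑ ^ 2 ≤ ∫⁻ z, ENNReal.ofReal (η z) * ‖g z‖ₑ ^ 2 ∂μ := by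
  have hp : IsProbabilityMeasure (μ.withDensity fun z => ENNReal.ofReal (η z)) :=
    ⟨by rw [withDensity_apply _ MeasurableSet.univ, Measure.restrict_univ, hη1]⟩
  have hm : Measurable fun z => ENNReal.ofReal (η z) := hη.ennreal_ofReal
  have hac := withDensity_absolutelyContinuous μ fun z => ENNReal.ofReal (η z)
  have h1 : ‖∫ z, η z • g z ∂μ‖ₑ ≤ ∫⁻ z, ‖g z‖ₑ ∂(μ.withDensity fun z => ENNReal.ofReal (η z)) := by
    refine (enorm_integral_le_lintegral_enorm _).trans_eq ?_
    rw [lintegral_withDensity_eq_lintegral_mul₀ hm.aemeasurable hg.enorm]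
    refine lintegral_congr fun z => ?_
    rw [enorm_smul, Real.enorm_eq_ofReal (hη0 z), Pi.mul_apply]
  calc _ ≤ (∫⁻ z, ‖g z‖ₑ ∂(μ.withDensity fun z => ENNReal.ofReal (η z))) ^ 2 := by gcongr
    _ ≤ ∫⁻ z, ‖g z‖ₑ ^ 2 ∂(μ.withDensity fun z => ENNReal.ofReal (η z)) :=
      sq_lintegral_le_lintegral_sq (hg.enorm.mono_ac hac)
    _ = _ := by
      rw [lintegral_withDensity_eq_lintegral_mul₀ hm.aemeasurable (hg.enorm.pow_const 2)]
      rfl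

/-- Continuity of translations in `L²`. -/
theorem exists_forall_eLpNorm_translate_sub_le {E F : Type*} [NormedAddCommGroup E]
    [NormedSpace ℝ E] [FiniteDimensional ℝ E] [MeasurableSpace E] [BorelSpace E] {μ : Measure E}
    [μ.IsAddHaarMeasure] [NormedAddCommGroup F] {v : E → F} (hv : MemLp v 2 μ) {δ : ℝ}
    (hδ : 0 < δ) :
    ∃ r > 0, ∀ h : E, ‖h‖ < r → eLpNorm (fun x => v (x + h) - v x) 2 μ ≤ ENNReal.ofReal δ := by
  have : Fact ((2 : ℝ≥0∞) ≠ ∞) := ⟨ENNReal.ofNat_ne_top⟩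
  have hcont : Continuous fun h : E => DomAddAct.mk h +ᵥ hv.toLp v :=
    (DomAddAct.continuous_mk.vadd continuous_const)
  have h0 := Metric.continuousAt_iff.1 (hcont.continuousAt (x := 0)) δ hδ
  obtain ⟨r, hr, h⟩ := h0
  refine ⟨r, hr, fun z hz => ?_⟩
  have h1 := h (x := z) (by simpa using hz)
  rw [DomAddAct.mk_zero, zero_vadd, DomAddAct.mk_vadd_toLp, dist_edist, Lp.edist_toLp_toLp] at h1
  have h2 : (fun x => v (x + z) - v x) = (fun x => v (z +ᵥ x)) - v := by
    ext x
    simp [add_comm]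
  rw [h2]
  refine (ENNReal.le_ofReal_iff_toReal_le ?_ hδ.le).2 h1.le
  exact ((hv.comp_measurePreserving (measurePreserving_vadd z μ)).sub hv).eLpNorm_ne_top

/-! ### Averages over translates -/

section BondEnergy

variable {d : ℕ}

local notation "𝔼" => EuclideanSpace ℝ (Fin d)

/-- The average of the translates `v(· + a - z)` with weight `η(z)`. -/
noncomputable def shiftAverage (η : 𝔼 → ℝ) (a : 𝔼) (v : 𝔼 → 𝔼) (x : 𝔼) : 𝔼 :=
  ∫ z, η z • v (x + a - z)

theorem shiftAverage_eq_convolution (η : 𝔼 → ℝ) (a : 𝔼) (v : 𝔼 → 𝔼) :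
    shiftAverage η a v = fun x => convolution η v (ContinuousLinearMap.lsmul ℝ ℝ) volume (x + a) :=
  rfl

theorem lintegral_normed_eq_one (φ : ContDiffBump (0 : 𝔼)) :
    ∫⁻ z, ENNReal.ofReal (φ.normed volume z) = 1 := by
  rw [← ofReal_integral_eq_lintegral_ofReal φ.integrable_normed
    (Eventually.of_forall φ.nonneg_normed), φ.integral_normed, ENNReal.ofReal_one]

theorem contDiff_shiftAverage (φ : ContDiffBump (0 : 𝔼)) (a : 𝔼) {v : 𝔼 → 𝔼}
    (hv : LocallyIntegrable v volume) :
    ContDiff ℝ 1 (shiftAverage (φ.normed volume) a v) := by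
  rw [shiftAverage_eq_convolution]
  exact (φ.hasCompactSupport_normed.contDiff_convolution_left _ (φ.contDiff_normed (n := 1))
    hv).comp (contDiff_id.add contDiff_const)

theorem integrable_smul_shift (φ : ContDiffBump (0 : 𝔼)) (a : 𝔼) {v : 𝔼 → 𝔼}
    (hv : LocallyIntegrable v volume) (x : 𝔼) :
    Integrable fun z => φ.normed volume z • v (x + a - z) :=
  φ.hasCompactSupport_normed.convolutionExists_left (ContinuousLinearMap.lsmul ℝ ℝ)
    φ.continuous_normed hv (x + a)

/-- Averaging of a nonnegative function over translates does not increase a bound on its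
translates' integrals. -/
theorem lintegral_lintegral_weight_le {α : Type*} [MeasurableSpace α] {μ : Measure α} [SFinite μ]
    (φ : ContDiffBump (0 : 𝔼)) {H : α → 𝔼 → ℝ≥0∞} (hH : Measurable (Function.uncurry H))
    {C : ℝ≥0∞} (h : ∀ z ∈ Metric.ball (0 : 𝔼) φ.rOut, ∫⁻ x, H x z ∂μ ≤ C) :
    ∫⁻ x, ∫⁻ z, ENNReal.ofReal (φ.normed volume z) * H x z ∂volume ∂μ ≤ C := by
  have hη : Measurable (φ.normed volume) := φ.continuous_normed.measurable
  rw [lintegral_lintegral_swap (by fun_prop)]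
  calc _ ≤ ∫⁻ z, ENNReal.ofReal (φ.normed volume z) * C := by
        refine lintegral_mono fun z => ?_
        rw [lintegral_const_mul _ (by fun_prop)]
        by_cases hz : z ∈ Metric.ball (0 : 𝔼) φ.rOut
        · exact mul_le_mul_right (h z hz) _
        · rw [← φ.support_normed_eq (μ := volume), Function.notMem_support] at hz
          simp [hz]
    _ = C := by rw [lintegral_mul_const _ (by fun_prop), lintegral_normed_eq_one, one_mul]

theorem lintegral_enorm_shiftAverage_sq_le (φ : ContDiffBump (0 : 𝔼)) (a : 𝔼) {v : 𝔼 → 𝔼}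
    (hv : Measurable v) :
    ∫⁻ x, ‖shiftAverage (φ.normed volume) a v x‖ₑ ^ 2 ≤ ∫⁻ x, ‖v x‖ₑ ^ 2 := by
  have hη : Measurable (φ.normed volume) := φ.continuous_normed.measurable
  refine (lintegral_mono fun x => enorm_integral_smul_sq_le hη φ.nonneg_normed
    (lintegral_normed_eq_one φ)
    (Measurable.aestronglyMeasurable (by fun_prop))).trans ?_
  refine lintegral_lintegral_weight_le φ (H := fun x z => ‖v (x + a - z)‖ₑ ^ 2) (by fun_prop)
    fun z _ => le_of_eq ?_
  simp_rw [add_sub_assoc]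
  exact lintegral_add_right_eq_self (fun x => ‖v x‖ₑ ^ 2) (a - z)

theorem eLpNorm_shiftAverage_sub_le (φ : ContDiffBump (0 : 𝔼)) (a : 𝔼) {v : 𝔼 → 𝔼}
    (hv : Measurable v) (hvi : LocallyIntegrable v volume) {C : ℝ≥0∞}
    (h : ∀ z ∈ Metric.ball (0 : 𝔼) φ.rOut,
      eLpNorm (fun x => v (x + (a - z)) - v x) 2 volume ≤ C) :
    eLpNorm (shiftAverage (φ.normed volume) a v - v) 2 volume ≤ C := by
  have hη : Measurable (φ.normed volume) := φ.continuous_normed.measurable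
  rw [← ENNReal.pow_le_pow_left_iff two_ne_zero, eLpNorm_two_sq]
  have heq : ∀ x, (shiftAverage (φ.normed volume) a v - v) x
      = ∫ z, φ.normed volume z • (v (x + a - z) - v x) := fun x => by
    simp_rw [smul_sub]
    rw [integral_sub (integrable_smul_shift φ a hvi x) (φ.integrable_normed.smul_const _),
      φ.integral_normed_smul]
    rfl
  simp_rw [heq]
  refine (lintegral_mono fun x => enorm_integral_smul_sq_le hη φ.nonneg_normed
    (lintegral_normed_eq_one φ)
    (Measurable.aestronglyMeasurable (by fun_prop))).trans ?_
  refine lintegral_lintegral_weight_le φ (H := fun x z => ‖v (x + a - z) - v x‖ₑ ^ 2)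
    (by fun_prop) fun z hz => ?_
  have := pow_le_pow_left' (h z hz) 2
  rw [eLpNorm_two_sq] at this
  simpa only [add_sub_assoc] using this

/-- The quotient is linear in the field, and its direction depends only on `y - x`, which a common
translation of both points preserves. -/
theorem bondQuot_shiftAverage (φ : ContDiffBump (0 : 𝔼)) (a : 𝔼) {v : 𝔼 → 𝔼}
    (hvi : LocallyIntegrable v volume) (p : 𝔼 × 𝔼) :
    bondQuot (shiftAverage (φ.normed volume) a v) p
      = ∫ z, φ.normed volume z • bondQuot v (p + (a - z, a - z)) := by
  have h1 := integrable_smul_shift φ a hvi p.1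
  have h2 := integrable_smul_shift φ a hvi p.2
  have hd : diffQuot (shiftAverage (φ.normed volume) a v) p.2 p.1
      = ∫ z, ‖p.2 - p.1‖⁻¹ • (φ.normed volume z • v (p.2 + a - z)
        - φ.normed volume z • v (p.1 + a - z)) := by
    rw [integral_smul, integral_sub h2 h1]
    rfl
  have hi : Integrable fun z => ‖p.2 - p.1‖⁻¹ • (φ.normed volume z • v (p.2 + a - z)
      - φ.normed volume z • v (p.1 + a - z)) := (h2.sub h1).smul (‖p.2 - p.1‖⁻¹)
  rw [bondQuot, hd, real_inner_comm, ← integral_inner hi]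
  refine integral_congr_ae (Eventually.of_forall fun z => ?_)
  have hs : p.2 + (a - z) - (p.1 + (a - z)) = p.2 - p.1 := by abel
  simp only [bondQuot, diffQuot, Prod.snd_add, Prod.fst_add, id, hs, ← smul_sub, add_sub_assoc,
    real_inner_smul_left, real_inner_smul_right, real_inner_comm (p.2 - p.1), smul_eq_mul]
  ring

theorem ofReal_mul_sq {r : ℝ} (hr : 0 ≤ r) (q : ℝ) :
    ENNReal.ofReal (r * q ^ 2) = ENNReal.ofReal r * ‖q‖ₑ ^ 2 := by
  rw [ENNReal.ofReal_mul hr, ← sq_abs, ENNReal.ofReal_pow (abs_nonneg q), Real.enorm_eq_ofReal_abs]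

/-- Averaging over inward translates does not increase the quadratic energy. -/
theorem bondEnergy_shiftAverage_le {Ω A : Set 𝔼} (hΩ : MeasurableSet Ω) (hA : MeasurableSet A)
    {R : 𝔼 → ℝ} (hR : Measurable R) (hR0 : ∀ ξ, 0 ≤ R ξ) (φ : ContDiffBump (0 : 𝔼)) (a : 𝔼)
    {v : 𝔼 → 𝔼} (hv : Measurable v) (hvi : LocallyIntegrable v volume)
    (h : ∀ x ∈ A, ∀ z ∈ Metric.ball (0 : 𝔼) φ.rOut, x + (a - z) ∈ Ω) :
    bondEnergy A R (shiftAverage (φ.normed volume) a v) ≤ bondEnergy Ω R v := by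
  have hη : Measurable (φ.normed volume) := φ.continuous_normed.measurable
  have hq := measurable_bondQuot hv
  set H : 𝔼 × 𝔼 → 𝔼 → ℝ≥0∞ := fun p z =>
    ENNReal.ofReal (R (p.2 - p.1) * bondQuot v (p + (a - z, a - z)) ^ 2) with hH
  have hle : bondEnergy A R (shiftAverage (φ.normed volume) a v)
      ≤ ∫⁻ p in A ×ˢ A, ∫⁻ z, ENNReal.ofReal (φ.normed volume z) * H p z := by
    refine lintegral_mono fun p => ?_
    rw [ofReal_mul_sq (hR0 _), bondQuot_shiftAverage φ a hvi]
    refine (mul_le_mul_right (enorm_integral_smul_sq_le hη φ.nonneg_normed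
      (lintegral_normed_eq_one φ)
    (Measurable.aestronglyMeasurable (by fun_prop))) _).trans_eq ?_
    rw [← lintegral_const_mul _ (by fun_prop)]
    refine lintegral_congr fun z => ?_
    simp only [hH]
    rw [ofReal_mul_sq (hR0 _), mul_left_comm]
  refine hle.trans (lintegral_lintegral_weight_le φ (by fun_prop) fun z hz => ?_)
  have hm := measurable_bondDensity hR hv
  -- For fixed `z` the common shift carries `A × A` into `Ω × Ω` and fixes `y - x`, hence also the
  -- weight `R`.
  calc ∫⁻ p in A ×ˢ A, H p z
      ≤ ∫⁻ p in A ×ˢ A, (Ω ×ˢ Ω).indicator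
          (fun p => ENNReal.ofReal (R (p.2 - p.1) * bondQuot v p ^ 2)) (p + (a - z, a - z)) := by
        refine setLIntegral_mono' (hA.prod hA) fun p hp => ?_
        rw [indicator_of_mem (show p + (a - z, a - z) ∈ Ω ×ˢ Ω from
          ⟨h _ hp.1 z hz, h _ hp.2 z hz⟩)]
        simp only [hH, Prod.snd_add, Prod.fst_add, add_sub_add_right_eq_sub, le_refl]
    _ ≤ ∫⁻ p, (Ω ×ˢ Ω).indicator
          (fun p => ENNReal.ofReal (R (p.2 - p.1) * bondQuot v p ^ 2)) (p + (a - z, a - z)) :=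
        setLIntegral_le_lintegral _ _
    _ = _ := by
        rw [Measure.volume_eq_prod, lintegral_add_right_eq_self, ← Measure.volume_eq_prod,
          lintegral_indicator (hΩ.prod hΩ)]
        rfl

/-! ### Density of Lipschitz fields with bounded energy -/

/-- Near any point of its closure, an open set with Lipschitz boundary is mapped into itself by
short translations along a cone of directions. -/
theorem HasLipschitzBoundary.exists_inward_cone {Ω : Set 𝔼} (hΩo : IsOpen Ω)
    (hΩl : HasLipschitzBoundary Ω) {x₀ : 𝔼} (hx₀ : x₀ ∈ closure Ω) :
    ∃ r > (0 : ℝ), ∃ (e : 𝔼) (κ τ : ℝ), 0 < κ ∧ 0 < τ ∧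
      ∀ x ∈ Ω ∩ Metric.ball x₀ r, ∀ t, 0 < t → t < τ → ∀ z : 𝔼, ‖z‖ < κ → x + t • (e + z) ∈ Ω := by
  by_cases hx : x₀ ∈ Ω
  · obtain ⟨r, hr, hball⟩ := Metric.isOpen_iff.1 hΩo x₀ hx
    -- At an interior point no direction is preferred: `e = 0` and short steps remain in the ball.
    refine ⟨r / 2, by positivity, 0, 1, r / 2, one_pos, by positivity, ?_⟩
    rintro x ⟨-, hxr⟩ t ht0 ht z hz
    apply hball
    rw [Metric.mem_ball, dist_eq_norm] at *
    have h1 : ‖t • ((0 : 𝔼) + z)‖ ≤ r / 2 := by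
      rw [zero_add, norm_smul, Real.norm_of_nonneg ht0.le]
      nlinarith [norm_nonneg z]
    rw [add_sub_right_comm]
    linarith [norm_add_le (x - x₀) (t • ((0 : 𝔼) + z))]
  · obtain ⟨r, hr, e, he, K, γ, hγ, hiff⟩ := hΩl x₀ ⟨hx₀, by rwa [hΩo.interior_eq]⟩
    have hK : (0 : ℝ) ≤ K := K.2
    -- Moving by `t (e + z)` gains height at least `t (1 - |z|)`, while the graph rises by at most
    -- `2 K t |z|`; the gain wins as soon as `(2K + 1) κ < 1`.
    set κ : ℝ := (2 * K + 2)⁻¹ with hκ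
    have hκ0 : 0 < κ := by positivity
    have hκ1 : κ ≤ 1 := inv_le_one_of_one_le₀ (by linarith)
    have hκK : 2 * K * κ + κ < 1 := by
      have : (2 * K + 2) * κ = 1 := mul_inv_cancel₀ (by positivity)
      linarith
    refine ⟨r / 2, by positivity, e, κ, r / 4, hκ0, by positivity, ?_⟩
    rintro x ⟨hxΩ, hxr⟩ t ht0 ht z hz
    have hxr' : ‖x - x₀‖ < r / 2 := by rwa [Metric.mem_ball, dist_eq_norm] at hxr
    have hmem : x + t • (e + z) ∈ Metric.ball x₀ r := by
      have h1 : ‖t • (e + z)‖ ≤ r / 2 := by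
        rw [norm_smul, Real.norm_of_nonneg ht0.le]
        have h2 : ‖e + z‖ ≤ 2 := (norm_add_le _ _).trans (by linarith)
        nlinarith [norm_nonneg (e + z)]
      rw [Metric.mem_ball, dist_eq_norm, add_sub_right_comm]
      linarith [norm_add_le (x - x₀) (t • (e + z))]
    have hxball : x ∈ Metric.ball x₀ r := Metric.ball_subset_ball (by linarith) hxr
    rw [hiff _ hmem]
    have hin := (hiff x hxball).1 hxΩ
    have hee : inner ℝ e e = (1 : ℝ) := by rw [real_inner_self_eq_norm_sq, he, one_pow]
    have hze : |inner ℝ z e| ≤ ‖z‖ := by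
      have := abs_real_inner_le_norm z e
      rwa [he, mul_one] at this
    have hinner : inner ℝ (x + t • (e + z)) e = inner ℝ x e + t * (1 + inner ℝ z e) := by
      rw [inner_add_left, real_inner_smul_left, inner_add_left, hee]
    have hdiff : x + t • (e + z) - inner ℝ (x + t • (e + z)) e • e
        = x - inner ℝ x e • e + t • (z - inner ℝ z e • e) := by
      rw [hinner]
      module
    have hlip : γ (x + t • (e + z) - inner ℝ (x + t • (e + z)) e • e)
        ≤ γ (x - inner ℝ x e • e) + K * (t * (2 * ‖z‖)) := by
      have h1 := hγ.norm_sub_le (x + t • (e + z) - inner ℝ (x + t • (e + z)) e • e)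
        (x - inner ℝ x e • e)
      rw [hdiff, add_sub_cancel_left, norm_smul, Real.norm_of_nonneg ht0.le] at h1
      rw [hdiff]
      have h2 : ‖z - inner ℝ z e • e‖ ≤ 2 * ‖z‖ := by
        refine (norm_sub_le _ _).trans ?_
        rw [norm_smul, he, mul_one, Real.norm_eq_abs]
        linarith
      have h3 : K * (t * ‖z - inner ℝ z e • e‖) ≤ K * (t * (2 * ‖z‖)) := by gcongr
      linarith [(le_abs_self _).trans h1]
    rw [hinner] at hlip ⊢
    have h4 : K * (t * (2 * ‖z‖)) + t * ‖z‖ < t := by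
      have h5 : K * (2 * ‖z‖) + ‖z‖ ≤ 2 * K * κ + κ := by nlinarith
      calc K * (t * (2 * ‖z‖)) + t * ‖z‖ = t * (K * (2 * ‖z‖) + ‖z‖) := by ring
        _ < t * 1 := by gcongr; linarith
        _ = t := mul_one t
    have h6 : -(t * ‖z‖) ≤ t * inner ℝ z e := by
      have := mul_le_mul_of_nonneg_left (neg_le_of_abs_le hze) ht0.le
      linarith
    linarith

open scoped Manifold ContDiff in
/-- A finite smooth partition of unity on a compact set subordinate to balls. -/
theorem IsCompact.exists_finite_partition_of_unity {s : Set 𝔼} (hs : IsCompact s) {r : 𝔼 → ℝ}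
    (hr : ∀ x ∈ s, 0 < r x) :
    ∃ (T : Finset 𝔼) (χ : T → 𝔼 → ℝ), (∀ i : T, (i : 𝔼) ∈ s) ∧ (∀ i, ContDiff ℝ 1 (χ i)) ∧
      (∀ i, HasCompactSupport (χ i)) ∧ (∀ i x, 0 ≤ χ i x) ∧ (∀ i x, χ i x ≤ 1) ∧
      (∀ i : T, ∀ x ∉ Metric.ball (i : 𝔼) (r i), χ i x = 0) ∧ ∀ x ∈ s, ∑ i, χ i x = 1 := by
  obtain ⟨T, hTs, hcov⟩ := hs.elim_nhds_subcover (fun x => Metric.ball x (r x))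
    fun x hx => Metric.ball_mem_nhds x (hr x hx)
  obtain ⟨f, hf⟩ := SmoothPartitionOfUnity.exists_isSubordinate 𝓘(ℝ, 𝔼) hs.isClosed
    (fun i : T => Metric.ball (i : 𝔼) (r i)) (fun i => Metric.isOpen_ball)
    (by simpa [iUnion_subtype] using hcov)
  refine ⟨T, fun i => f i, fun i => hTs i i.2, fun i => ?_, fun i => ?_, fun i x => f.nonneg i x,
    fun i x => f.le_one i x, fun i x hx => ?_, fun x hx => ?_⟩
  · exact ((f i).contMDiff.contDiff).of_le (by simp)
  · exact (isCompact_closedBall (i : 𝔼) (r i)).of_isClosed_subset (isClosed_tsupport _)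
      ((hf i).trans Metric.ball_subset_closedBall)
  · by_contra h
    exact hx (hf i (subset_tsupport _ h))
  · have := f.sum_eq_one hx
    rwa [finsum_eq_sum_of_fintype] at this

/-- The effect of a Lipschitz cutoff on the quadratic energy. -/
theorem bondEnergy_cutoff_le {Ω B : Set 𝔼} (hB : MeasurableSet B) {R : 𝔼 → ℝ} (hR : Measurable R)
    (hR0 : ∀ ξ, 0 ≤ R ξ) {M : ℝ≥0∞}
    (hM : ∀ g : 𝔼 → ℝ≥0∞, Measurable g →
      ∫⁻ p in Ω ×ˢ Ω, ENNReal.ofReal (R (p.2 - p.1)) * g p.1 ≤ M * ∫⁻ x in Ω, g x ∧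
      ∫⁻ p in Ω ×ˢ Ω, ENNReal.ofReal (R (p.2 - p.1)) * g p.2 ≤ M * ∫⁻ x in Ω, g x)
    {χ : 𝔼 → ℝ} {L : NNReal} (hχL : LipschitzWith L χ) (hχ0 : ∀ x, 0 ≤ χ x) (hχ1 : ∀ x, χ x ≤ 1)
    (hχB : ∀ x ∉ B, χ x = 0) {S : 𝔼 → 𝔼} (hS : Measurable S) :
    bondEnergy Ω R (fun x => χ x • S x) ≤ 2 * bondEnergy (Ω ∩ B) R S
      + 4 * (L : ℝ≥0∞) ^ 2 * M * ∫⁻ x in Ω, ‖S x‖ₑ ^ 2 := by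
  have hpt : ∀ x y w : 𝔼, y - x ≠ 0 → ‖y - x‖⁻¹ * ‖(χ y - χ x) • w‖ ≤ L * ‖w‖ := by
    intro x y w hxy
    rw [norm_smul, ← mul_assoc]
    refine mul_le_mul_of_nonneg_right ?_ (norm_nonneg w)
    rw [inv_mul_le_iff₀ (norm_pos_iff.2 hxy), mul_comm]
    exact hχL.norm_sub_le _ _
  -- Product rule: `χ(y) S(y) - χ(x) S(x) = χ(y) (S(y) - S(x)) + (χ(y) - χ(x)) S(x)`. If a point
  -- lies outside `B`, where `χ = 0`, only a Lipschitz term remains, so the quotient of `S` is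
  -- needed on `B × B` alone.
  have key : ∀ p : 𝔼 × 𝔼, bondQuot (fun x => χ x • S x) p ^ 2
      ≤ 2 * (B ×ˢ B).indicator (fun p => bondQuot S p ^ 2) p
        + 2 * (L ^ 2 * (‖S p.1‖ ^ 2 + ‖S p.2‖ ^ 2)) := by
    rintro ⟨x, y⟩
    by_cases hxy : y - x = 0
    · have h0 : bondQuot (fun x => χ x • S x) (x, y) = 0 := by simp [bondQuot, diffQuot, hxy]
      rw [h0]
      have h1 : 0 ≤ (B ×ˢ B).indicator (fun p => bondQuot S p ^ 2) (x, y) :=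
        indicator_nonneg (fun _ _ => sq_nonneg _) _
      have h2 : 0 ≤ 2 * ((L : ℝ) ^ 2 * (‖S (x, y).1‖ ^ 2 + ‖S (x, y).2‖ ^ 2)) := by positivity
      linarith
    have hlin : ∀ w : 𝔼, |inner ℝ (‖y - x‖⁻¹ • ((χ y - χ x) • w)) (diffQuot id y x)| ^ 2
        ≤ L ^ 2 * ‖w‖ ^ 2 := by
      intro w
      rw [← mul_pow]
      refine pow_le_pow_left₀ (abs_nonneg _) ?_ 2
      refine (abs_real_inner_le_norm _ _).trans ?_
      refine (mul_le_of_le_one_right (norm_nonneg _) (norm_diffQuot_id_le _ _)).trans ?_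
      rw [norm_smul, norm_inv, norm_norm]
      exact hpt x y w hxy
    have hx2 : 0 ≤ (L : ℝ) ^ 2 * ‖S x‖ ^ 2 := by positivity
    have hy2 : 0 ≤ (L : ℝ) ^ 2 * ‖S y‖ ^ 2 := by positivity
    by_cases hy : y ∈ B
    · by_cases hx : x ∈ B
      · rw [indicator_of_mem (show (x, y) ∈ B ×ˢ B from ⟨hx, hy⟩)]
        have hsplit : bondQuot (fun x => χ x • S x) (x, y) = χ y * bondQuot S (x, y)
            + inner ℝ (‖y - x‖⁻¹ • ((χ y - χ x) • S x)) (diffQuot id y x) := by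
          simp only [bondQuot, ← real_inner_smul_left, ← inner_add_left]
          congr 1
          simp only [diffQuot]
          module
        have h1 := hlin (S x)
        rw [sq_abs] at h1
        have h2 : (χ y * bondQuot S (x, y)) ^ 2 ≤ bondQuot S (x, y) ^ 2 := by
          rw [mul_pow]
          exact mul_le_of_le_one_left (sq_nonneg _) (pow_le_one₀ (hχ0 y) (hχ1 y))
        rw [hsplit]
        refine (add_sq_le).trans ?_
        simp only
        linarith
      · have h0 : (x, y) ∉ B ×ˢ B := fun h => hx h.1
        rw [indicator_of_notMem h0]
        have heq : bondQuot (fun x => χ x • S x) (x, y)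
            = inner ℝ (‖y - x‖⁻¹ • ((χ y - χ x) • S y)) (diffQuot id y x) := by
          simp [bondQuot, diffQuot, hχB x hx]
        have h1 := hlin (S y)
        rw [sq_abs] at h1
        rw [heq]
        simp only
        linarith
    · have h0 : (x, y) ∉ B ×ˢ B := fun h => hy h.2
      rw [indicator_of_notMem h0]
      have heq : bondQuot (fun x => χ x • S x) (x, y)
          = inner ℝ (‖y - x‖⁻¹ • ((χ y - χ x) • S x)) (diffQuot id y x) := by
        simp [bondQuot, diffQuot, hχB y hy]
      have h1 := hlin (S x)
      rw [sq_abs] at h1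
      rw [heq]
      simp only
      linarith
  have hS2 : Measurable fun x => ‖S x‖ₑ ^ 2 := by fun_prop
  have hSm := measurable_bondDensity hR hS
  have hnorm : ∀ w : 𝔼, ENNReal.ofReal (‖w‖ ^ 2) = ‖w‖ₑ ^ 2 := fun w => by
    rw [ENNReal.ofReal_pow (norm_nonneg w), ofReal_norm]
  have hdens : ∀ p : 𝔼 × 𝔼, ENNReal.ofReal (R (p.2 - p.1) * bondQuot (fun x => χ x • S x) p ^ 2)
      ≤ 2 * (B ×ˢ B).indicator
          (fun p => ENNReal.ofReal (R (p.2 - p.1) * bondQuot S p ^ 2)) p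
        + (2 * (L : ℝ≥0∞) ^ 2 * (ENNReal.ofReal (R (p.2 - p.1)) * ‖S p.1‖ₑ ^ 2)
          + 2 * (L : ℝ≥0∞) ^ 2 * (ENNReal.ofReal (R (p.2 - p.1)) * ‖S p.2‖ₑ ^ 2)) := by
    intro p
    have h0 := hR0 (p.2 - p.1)
    have hind : 0 ≤ (B ×ˢ B).indicator (fun p => bondQuot S p ^ 2) p :=
      indicator_nonneg (fun _ _ => sq_nonneg _) _
    refine (ENNReal.ofReal_le_ofReal (mul_le_mul_of_nonneg_left (key p) h0)).trans_eq ?_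
    rw [mul_add, ENNReal.ofReal_add (by positivity) (by positivity)]
    congr 1
    · rw [mul_left_comm, ENNReal.ofReal_mul two_pos.le, ENNReal.ofReal_ofNat]
      congr 1
      by_cases hp : p ∈ B ×ˢ B
      · simp only [indicator_of_mem hp]
      · simp only [indicator_of_notMem hp, mul_zero, ENNReal.ofReal_zero]
    · have : R (p.2 - p.1) * (2 * (L ^ 2 * (‖S p.1‖ ^ 2 + ‖S p.2‖ ^ 2)))
          = 2 * (L : ℝ) ^ 2 * (R (p.2 - p.1) * ‖S p.1‖ ^ 2)
            + 2 * (L : ℝ) ^ 2 * (R (p.2 - p.1) * ‖S p.2‖ ^ 2) := by ring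
      have hL2 : ENNReal.ofReal (2 * (L : ℝ) ^ 2) = 2 * (L : ℝ≥0∞) ^ 2 := by
        rw [ENNReal.ofReal_mul two_pos.le, ENNReal.ofReal_ofNat, ENNReal.ofReal_pow L.coe_nonneg,
          ENNReal.ofReal_coe_nnreal]
      have h2L : (0 : ℝ) ≤ 2 * (L : ℝ) ^ 2 := by positivity
      rw [this, ENNReal.ofReal_add (by positivity) (by positivity),
        ENNReal.ofReal_mul h2L, ENNReal.ofReal_mul h2L, hL2,
        ENNReal.ofReal_mul h0, ENNReal.ofReal_mul h0, hnorm, hnorm]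
  have hBB := hB.prod hB
  refine (lintegral_mono hdens).trans ?_
  rw [lintegral_add_left ((hSm.indicator hBB).const_mul 2),
    lintegral_add_left (by fun_prop), lintegral_const_mul _ (hSm.indicator hBB),
    lintegral_const_mul _ (by fun_prop), lintegral_const_mul _ (by fun_prop),
    lintegral_indicator hBB, Measure.restrict_restrict hBB, prod_inter_prod, inter_comm B Ω]
  refine add_le_add le_rfl ?_
  calc _ ≤ 2 * (L : ℝ≥0∞) ^ 2 * (M * ∫⁻ x in Ω, ‖S x‖ₑ ^ 2)
        + 2 * (L : ℝ≥0∞) ^ 2 * (M * ∫⁻ x in Ω, ‖S x‖ₑ ^ 2) :=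
        add_le_add (mul_le_mul_right (hM _ hS2).1 _) (mul_le_mul_right (hM _ hS2).2 _)
    _ = _ := by ring

/-- Smooth approximation along a cone of inward directions, with controlled energy. -/
theorem exists_contDiff_approx_of_cone {Ω A : Set 𝔼} (hΩ : MeasurableSet Ω) (hA : MeasurableSet A)
    {R : 𝔼 → ℝ} (hR : Measurable R) (hR0 : ∀ ξ, 0 ≤ R ξ) {v : 𝔼 → 𝔼} (hv : Measurable v)
    (hv2 : MemLp v 2 volume) {e : 𝔼} {κ τ : ℝ} (hκ : 0 < κ) (hτ : 0 < τ)
    (hcone : ∀ x ∈ A, ∀ t, 0 < t → t < τ → ∀ z : 𝔼, ‖z‖ < κ → x + t • (e + z) ∈ Ω)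
    {δ : ℝ} (hδ : 0 < δ) :
    ∃ S : 𝔼 → 𝔼, ContDiff ℝ 1 S ∧ eLpNorm (S - v) 2 volume ≤ ENNReal.ofReal δ ∧
      ∫⁻ x, ‖S x‖ₑ ^ 2 ≤ ∫⁻ x, ‖v x‖ₑ ^ 2 ∧ bondEnergy A R S ≤ bondEnergy Ω R v := by
  have hvi : LocallyIntegrable v volume := hv2.locallyIntegrable one_le_two
  obtain ⟨r, hr, htrans⟩ := exists_forall_eLpNorm_translate_sub_le hv2 hδ
  -- Shifts `t e - z` with `|z| < t κ` lie in the cone scaled by `t < τ` and are shorter than `r`,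
  -- the scale of `L²` continuity.
  set t : ℝ := min (τ / 2) (r / (2 * (‖e‖ + κ))) with ht
  have hek : 0 < ‖e‖ + κ := by positivity
  have ht0 : 0 < t := lt_min (by positivity) (by positivity)
  have htτ : t < τ := (min_le_left _ _).trans_lt (by linarith)
  have htr : t * (‖e‖ + κ) < r := by
    have h1 : t * (2 * (‖e‖ + κ)) ≤ r := (le_div_iff₀ (by positivity)).1 (min_le_right _ _)
    nlinarith [mul_pos ht0 hek]
  have htκ : 0 < t * κ := by positivity
  let φ : ContDiffBump (0 : 𝔼) := ⟨t * κ / 2, t * κ, by positivity, by linarith⟩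
  have hz : ∀ z ∈ Metric.ball (0 : 𝔼) φ.rOut, ‖z‖ < t * κ := fun z hz => by
    simpa using hz
  refine ⟨shiftAverage (φ.normed volume) (t • e) v, contDiff_shiftAverage φ _ hvi,
    eLpNorm_shiftAverage_sub_le φ _ hv hvi fun z hzb => htrans _ ?_,
    lintegral_enorm_shiftAverage_sq_le φ _ hv,
    bondEnergy_shiftAverage_le hΩ hA hR hR0 φ _ hv hvi fun x hx z hzb => ?_⟩
  · refine (norm_sub_le _ _).trans_lt ?_
    rw [norm_smul, Real.norm_of_nonneg ht0.le]
    linarith [hz z hzb]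
  · have h1 : t • e - z = t • (e + -(t⁻¹ • z)) := by
      rw [smul_add, smul_neg, smul_smul, mul_inv_cancel₀ ht0.ne', one_smul, sub_eq_add_neg]
    rw [h1]
    refine hcone x hx t ht0 htτ _ ?_
    rw [norm_neg, norm_smul, norm_inv, Real.norm_of_nonneg ht0.le, inv_mul_lt_iff₀ ht0]
    exact hz z hzb

/-- Fields of finite energy on a bounded Lipschitz domain are limits of Lipschitz fields with
bounded energies. -/
theorem exists_lipschitz_approx_bounded {Ω : Set 𝔼} (hΩo : IsOpen Ω)
    (hΩb : Bornology.IsBounded Ω) (hΩl : HasLipschitzBoundary Ω) {R : 𝔼 → ℝ} (hRm : Measurable R)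
    (hR : LocallyIntegrable R volume) (hR0 : ∀ ξ, 0 ≤ R ξ) {u : 𝔼 → 𝔼} (hu : Measurable u)
    (hu2 : MemLp u 2 (volume.restrict Ω)) (hE : bondEnergy Ω R u ≠ ∞) :
    ∃ C : ℝ≥0∞, C ≠ ∞ ∧ ∀ δ > (0 : ℝ), ∃ f : 𝔼 → 𝔼, (∃ L : NNReal, LipschitzWith L f) ∧
      eLpNorm (f - u) 2 (volume.restrict Ω) ≤ ENNReal.ofReal δ ∧ bondEnergy Ω R f ≤ C := by
  have hΩm := hΩo.measurableSet
  set v : 𝔼 → 𝔼 := Ω.indicator u with hvdef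
  have hv : Measurable v := hu.indicator hΩm
  have hv2 : MemLp v 2 volume := (memLp_indicator_iff_restrict hΩm).2 hu2
  have hvu : v =ᵐ[volume.restrict Ω] u := indicator_ae_eq_restrict hΩm
  have hEv : bondEnergy Ω R v ≠ ∞ := by rwa [bondEnergy_congr hvu]
  obtain ⟨M, hM, hMle⟩ := exists_lintegral_kernel_mul_le hΩm hΩb hRm hR
  have hloc := fun x (hx : x ∈ closure Ω) => hΩl.exists_inward_cone hΩo hx
  choose! r hr e κ τ hκ hτ hcone using hloc
  obtain ⟨T, χ, hTs, hχd, hχc, hχ0, hχ1, hχB, hχsum⟩ :=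
    hΩb.isCompact_closure.exists_finite_partition_of_unity hr
  have hχL : ∀ i, ∃ L : NNReal, LipschitzWith L (χ i) := fun i =>
    ContDiff.lipschitzWith_of_hasCompactSupport (hχc i) (hχd i) one_ne_zero
  choose L hL using hχL
  set V : ℝ≥0∞ := ∫⁻ x, ‖v x‖ₑ ^ 2 with hV
  have hVfin : V ≠ ∞ := by
    rw [hV, ← eLpNorm_two_sq]
    exact ENNReal.pow_ne_top hv2.eLpNorm_ne_top
  -- The cutoffs and their Lipschitz constants are fixed before `δ`, so this bound does not depend
  -- on `δ`.
  refine ⟨(Finset.univ : Finset T).card *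
    ∑ i : T, (2 * bondEnergy Ω R v + 4 * (L i : ℝ≥0∞) ^ 2 * M * V), ?_, fun δ hδ => ?_⟩
  · refine ENNReal.mul_ne_top (ENNReal.natCast_ne_top _) (ENNReal.sum_ne_top.2 fun i _ => ?_)
    refine ENNReal.add_ne_top.2 ⟨ENNReal.mul_ne_top ENNReal.ofNat_ne_top hEv, ?_⟩
    exact ENNReal.mul_ne_top (ENNReal.mul_ne_top (ENNReal.mul_ne_top ENNReal.ofNat_ne_top
      (ENNReal.pow_ne_top ENNReal.coe_ne_top)) hM) hVfin
  · have hex : ∀ i : T, ∃ S : 𝔼 → 𝔼, ContDiff ℝ 1 S ∧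
        eLpNorm (S - v) 2 volume ≤ ENNReal.ofReal (δ / (T.card + 1)) ∧
        ∫⁻ x, ‖S x‖ₑ ^ 2 ≤ V ∧
        bondEnergy (Ω ∩ Metric.ball (i : 𝔼) (r i)) R S ≤ bondEnergy Ω R v := fun i =>
      exists_contDiff_approx_of_cone hΩm (hΩm.inter measurableSet_ball) hRm hR0 hv hv2
        (hκ i (hTs i)) (hτ i (hTs i)) (hcone i (hTs i)) (by positivity)
    choose S hSd hSv hSV hSE using hex
    have hterm : ∀ i, ContDiff ℝ 1 fun x => χ i x • S i x := fun i => (hχd i).smul (hSd i)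
    have htermL : ∀ i, ∃ L : NNReal, LipschitzWith L fun x => χ i x • S i x := fun i =>
      ContDiff.lipschitzWith_of_hasCompactSupport (hχc i).smul_right (hterm i) one_ne_zero
    choose L' hL' using htermL
    refine ⟨∑ i : T, fun x => χ i x • S i x, ⟨∑ i, L' i, ?_⟩, ?_, ?_⟩
    · refine LipschitzWith.of_dist_le_mul fun x y => ?_
      rw [dist_eq_norm, dist_eq_norm, Finset.sum_apply, Finset.sum_apply, ← Finset.sum_sub_distrib,
        NNReal.coe_sum, Finset.sum_mul]
      exact (norm_sum_le _ _).trans (Finset.sum_le_sum fun i _ => (hL' i).norm_sub_le x y)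
    -- As the cutoffs sum to one on `Ω`, the error is the weighted sum of the local errors.
    · have hae : (∑ i : T, fun x => χ i x • S i x) - u =ᵐ[volume.restrict Ω]
          ∑ i : T, fun x => χ i x • (S i - v) x := by
        filter_upwards [hvu, self_mem_ae_restrict hΩm] with x hx hxΩ
        simp only [Pi.sub_apply, Finset.sum_apply, smul_sub, Finset.sum_sub_distrib,
          ← Finset.sum_smul, hχsum x (subset_closure hxΩ), one_smul, hx]
      rw [eLpNorm_congr_ae hae]
      refine (eLpNorm_sum_le (fun i _ => ?_) one_le_two).trans ?_
      · exact ((hχd i).continuous.measurable.smul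
          ((hSd i).continuous.measurable.sub hv)).aestronglyMeasurable
      · calc ∑ i : T, eLpNorm (fun x => χ i x • (S i - v) x) 2 (volume.restrict Ω)
            ≤ ∑ i : T, ENNReal.ofReal (δ / (T.card + 1)) := by
              refine Finset.sum_le_sum fun i _ => ?_
              refine le_trans (eLpNorm_mono fun x => ?_)
                ((eLpNorm_mono_measure _ Measure.restrict_le_self).trans (hSv i))
              rw [norm_smul, Real.norm_of_nonneg (hχ0 i x)]
              exact mul_le_of_le_one_left (norm_nonneg _) (hχ1 i x)
          _ = ENNReal.ofReal (T.card * (δ / (T.card + 1))) := by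
              rw [Finset.sum_const, Finset.card_univ, Fintype.card_coe, nsmul_eq_mul,
                ENNReal.ofReal_mul (by positivity), ENNReal.ofReal_natCast]
          _ ≤ ENNReal.ofReal δ := by
              refine ENNReal.ofReal_le_ofReal ?_
              rw [mul_div_assoc', div_le_iff₀ (by positivity)]
              nlinarith
    · refine (bondEnergy_sum_le hRm hR0 Finset.univ fun i =>
        (hterm i).continuous.measurable).trans (mul_le_mul_right (Finset.sum_le_sum fun i _ => ?_) _)
      refine (bondEnergy_cutoff_le measurableSet_ball hRm hR0 hMle (hL i) (hχ0 i) (hχ1 i) (hχB i)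
        (hSd i).continuous.measurable).trans ?_
      gcongr
      · exact hSE i
      · exact (setLIntegral_le_lintegral _ _).trans (hSV i)

end BondEnergy

/-! ### Diagonal sequences and limits in `EReal` -/

/-- Diagonal selection. -/
theorem exists_tendsto_atTop_diagonal {P : ℕ → ℕ → Prop} (h : ∀ N, ∀ᶠ n in atTop, P N n) :
    ∃ φ : ℕ → ℕ, Tendsto φ atTop atTop ∧ ∀ᶠ n in atTop, P (φ n) n := by
  classical
  choose T hT using fun N => eventually_atTop.1 (h N)
  -- The largest `N ≤ n` whose threshold has been passed; the thresholds need not be monotone.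
  refine ⟨fun n => Nat.findGreatest (fun N => T N ≤ n) n, ?_, ?_⟩
  · refine tendsto_atTop.2 fun m => ?_
    filter_upwards [eventually_ge_atTop (max m (T m))] with n hn
    exact Nat.le_findGreatest ((le_max_left _ _).trans hn) ((le_max_right _ _).trans hn)
  · filter_upwards [eventually_ge_atTop (T 0)] with n hn
    exact hT _ n (Nat.findGreatest_spec (P := fun N => T N ≤ n) (Nat.zero_le n) hn)

theorem coe_ennreal_ereal_monotone : Monotone ((↑) : ℝ≥0∞ → EReal) :=
  fun _ _ h => EReal.coe_ennreal_le_coe_ennreal_iff.2 h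

/-- The load term is real and convergent, so it passes through the liminf without any `∞ - ∞`. -/
theorem coe_sub_le_liminf {a : ℝ≥0∞} {A : ℕ → ℝ≥0∞} {l : ℝ} {b : ℕ → ℝ}
    (hA : a ≤ liminf A atTop) (hb : Tendsto b atTop (𝓝 l)) :
    (a : EReal) - (l : EReal) ≤ liminf (fun n => (A n : EReal) - (b n : EReal)) atTop := by
  have h1 : (a : EReal) ≤ liminf (fun n => (A n : EReal)) atTop := by
    refine (EReal.coe_ennreal_le_coe_ennreal_iff.2 hA).trans_eq ?_
    exact coe_ennreal_ereal_monotone.map_liminf_of_continuousAt A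
      continuous_coe_ennreal_ereal.continuousAt
  have h2 : liminf (fun n => -(b n : EReal)) atTop = -(l : EReal) :=
    Tendsto.liminf_eq (((continuous_coe_real_ereal.tendsto l).comp hb).neg)
  simp only [sub_eq_add_neg]
  refine le_trans ?_ EReal.le_liminf_add
  rw [h2]
  exact add_le_add h1 le_rfl

theorem limsup_coe_sub_le {a : ℝ≥0∞} {A : ℕ → ℝ≥0∞} {l : ℝ} {b : ℕ → ℝ}
    (hA : limsup A atTop ≤ a) (hb : Tendsto b atTop (𝓝 l)) :
    limsup (fun n => (A n : EReal) - (b n : EReal)) atTop ≤ (a : EReal) - (l : EReal) := by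
  have h1 : limsup (fun n => (A n : EReal)) atTop ≤ (a : EReal) := by
    refine le_trans (le_of_eq ?_) (EReal.coe_ennreal_le_coe_ennreal_iff.2 hA)
    exact (coe_ennreal_ereal_monotone.map_limsup_of_continuousAt A
      continuous_coe_ennreal_ereal.continuousAt).symm
  have h2 : limsup (fun n => -(b n : EReal)) atTop = -(l : EReal) :=
    Tendsto.limsup_eq (((continuous_coe_real_ereal.tendsto l).comp hb).neg)
  simp only [sub_eq_add_neg]
  refine (EReal.limsup_add_le (.inr ?_) (.inr ?_)).trans ?_
  · rw [h2, ← EReal.coe_neg]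
    exact EReal.coe_ne_top _
  · rw [h2, ← EReal.coe_neg]
    exact EReal.coe_ne_bot _
  · rw [h2]
    exact add_le_add h1 le_rfl

/-! ### The two bounds on `L²` -/

section Energies

variable {d : ℕ} {Ω : Set (EuclideanSpace ℝ (Fin d))}

theorem tendsto_loadWork (l : L2Field Ω) {v : ℕ → L2Field Ω} {u : L2Field Ω}
    (hv : Tendsto v atTop (𝓝 u)) :
    Tendsto (fun n => loadWork l (v n)) atTop (𝓝 (loadWork l u)) := by
  have h : ∀ w : L2Field Ω, loadWork l w = inner ℝ l w := fun w => (L2.inner_def l w).symm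
  simp only [h]
  exact tendsto_const_nhds.inner hv

theorem extNonlinearEnergy_eq (w : EuclideanSpace ℝ (Fin d) → ℝ → ℝ) (l : L2Field Ω) (ε : ℝ)
    (u : L2Field Ω) : extNonlinearEnergy w l ε u = nonlinearEnergy w l ε u := by
  rw [extNonlinearEnergy]
  split_ifs with h
  · rfl
  · exact (not_lt_top_iff.1 h).symm

/-- Outside the space the form is `∞` and the load is real, so the formula already gives `⊤`. -/
theorem extLinearizedEnergy_eq (ρ : EuclideanSpace ℝ (Fin d) → ℝ) (l u : L2Field Ω) :
    extLinearizedEnergy ρ l u = linearizedEnergy ρ l u := by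
  rw [extLinearizedEnergy]
  split_ifs with h
  · rfl
  · have hT : bondForm ρ u = ∞ := not_lt_top_iff.1 h
    rw [linearizedEnergy, hT, ENNReal.mul_top (by simp), EReal.coe_ennreal_top, EReal.top_sub_coe]

/-- The lower bound along `L²`-convergent sequences. -/
theorem bondEnergy_le_liminf_storedEnergy_of_tendsto [Nontrivial (EuclideanSpace ℝ (Fin d))]
    {W : EuclideanSpace ℝ (Fin d) → ℝ → ℝ} {R : EuclideanSpace ℝ (Fin d) → ℝ}
    (hW : Measurable (Function.uncurry W)) (hR : Measurable R)
    (hlim : ∀ ξ, (fun s => W ξ s - R ξ / 2 * s ^ 2) =o[𝓝 0] fun s => s ^ 2) {ε : ℕ → ℝ}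
    (hε0 : ∀ n, 0 < ε n) (hε : Tendsto ε atTop (𝓝 0)) {v : ℕ → L2Field Ω} {u : L2Field Ω}
    (hv : Tendsto v atTop (𝓝 u)) :
    2⁻¹ * bondEnergy Ω R u ≤ liminf (fun n => storedEnergy Ω W (ε n) (v n)) atTop := by
  -- Fatou's lemma needs a.e. convergence, which holds only along a subsequence; it is extracted
  -- among the indices whose energies stay below a level `c` under the claimed bound.
  by_contra! hlt
  obtain ⟨c, hc1, hc2⟩ := exists_between hlt
  obtain ⟨φ, hφ, hφc⟩ := extraction_of_frequently_atTop
    (frequently_lt_of_liminf_lt (by isBoundedDefault) hc1)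
  obtain ⟨ψ, hψ, hae⟩ := (tendstoInMeasure_of_tendsto_Lp
    (hv.comp hφ.tendsto_atTop)).exists_seq_tendsto_ae
  have h := bondEnergy_le_liminf_storedEnergy (ε := fun n => ε (φ (ψ n)))
    (f := fun n => v (φ (ψ n))) hW hR hlim (fun n => hε0 _)
    (hε.comp (hφ.tendsto_atTop.comp hψ.tendsto_atTop))
    (fun n => (Lp.stronglyMeasurable _).measurable) (Lp.stronglyMeasurable u).measurable hae
  refine absurd hc2 (not_lt.2 (h.trans ?_))
  refine (liminf_le_liminf (Eventually.of_forall fun n => (hφc (ψ n)).le)).trans_eq ?_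
  exact tendsto_const_nhds.liminf_eq

/-- Recovery sequences for the stored energy. -/
theorem exists_tendsto_limsup_storedEnergy_le [Nontrivial (EuclideanSpace ℝ (Fin d))]
    (hΩo : IsOpen Ω) (hΩb : Bornology.IsBounded Ω) (hΩl : HasLipschitzBoundary Ω)
    {W : EuclideanSpace ℝ (Fin d) → ℝ → ℝ} {R : EuclideanSpace ℝ (Fin d) → ℝ} {C δ₀ : ℝ}
    (hW : Measurable (Function.uncurry W)) (hRm : Measurable R) (hR : LocallyIntegrable R volume)
    (hR0 : ∀ ξ, 0 ≤ R ξ) (hC : 0 ≤ C) (hδ₀ : 0 < δ₀)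
    (hle : ∀ ξ s, |s| < δ₀ → W ξ s ≤ C * R ξ * s ^ 2)
    (hlim : ∀ ξ, (fun s => W ξ s - R ξ / 2 * s ^ 2) =o[𝓝 0] fun s => s ^ 2) {ε : ℕ → ℝ}
    (hε0 : ∀ n, 0 < ε n) (hε : Tendsto ε atTop (𝓝 0)) (u : L2Field Ω) :
    ∃ v : ℕ → L2Field Ω, Tendsto v atTop (𝓝 u) ∧
      limsup (fun n => storedEnergy Ω W (ε n) (v n)) atTop ≤ 2⁻¹ * bondEnergy Ω R u := by
  by_cases hE : bondEnergy Ω R u = ∞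
  · exact ⟨fun _ => u, tendsto_const_nhds, by simp [hE]⟩
  have hum : Measurable u := (Lp.stronglyMeasurable u).measurable
  obtain ⟨B, hB, hap⟩ := exists_lipschitz_approx_bounded hΩo hΩb hΩl hRm hR hR0 hum (Lp.memLp u) hE
  have hex := fun N : ℕ => exists_lipschitz_bondEnergy_le_add hRm hR0 hum hE hB hap
    (δ := 1 / ((N : ℝ) + 1)) (by positivity)
  choose f hfL hfu hfE using hex
  choose L hL using hfL
  have hfm : ∀ N, MemLp (f N) 2 (volume.restrict Ω) := fun N => by
    have h1 : MemLp (f N - ⇑u) 2 (volume.restrict Ω) :=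
      ⟨((hL N).continuous.measurable.sub hum).aestronglyMeasurable,
        (hfu N).trans_lt ENNReal.ofReal_lt_top⟩
    have h2 := h1.add (Lp.memLp u)
    rwa [sub_add_cancel] at h2
  have hzero : Tendsto (fun N : ℕ => ENNReal.ofReal (1 / ((N : ℝ) + 1))) atTop (𝓝 0) := by
    simpa using ENNReal.tendsto_ofReal (tendsto_one_div_add_atTop_nhds_zero_nat (𝕜 := ℝ))
  have hconv : Tendsto (fun N => (hfm N).toLp (f N)) atTop (𝓝 u) := by
    refine (Lp.tendsto_Lp_iff_tendsto_eLpNorm' _ _).2 ?_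
    refine tendsto_of_tendsto_of_tendsto_of_le_of_le tendsto_const_nhds hzero
      (fun N => zero_le) fun N => ?_
    refine le_of_eq_of_le (eLpNorm_congr_ae ?_) (hfu N)
    exact (hfm N).coeFn_toLp.sub EventuallyEq.rfl
  -- For fixed `N` the constant sequence `f N` recovers its own energy; letting `N` grow slowly with
  -- `n` gives the recovery sequence for `u`.
  have hdiag : ∀ N : ℕ, ∀ᶠ n in atTop, storedEnergy Ω W (ε n) (f N)
      ≤ 2⁻¹ * (bondEnergy Ω R u + ENNReal.ofReal (1 / ((N : ℝ) + 1)))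
        + ENNReal.ofReal (1 / ((N : ℝ) + 1)) := by
    intro N
    have h1 := tendsto_storedEnergy_of_lipschitz hΩo.measurableSet hΩb hW hRm hR hR0 hC hδ₀ hle hlim
      hε0 hε (hL N)
    have hpos : ENNReal.ofReal (1 / ((N : ℝ) + 1)) ≠ 0 := by
      rw [Ne, ENNReal.ofReal_eq_zero, not_le]
      positivity
    have hfin : 2⁻¹ * bondEnergy Ω R (f N) ≠ ∞ := by
      refine ENNReal.mul_ne_top (by simp) (ne_top_of_le_ne_top ?_ (hfE N))
      exact ENNReal.add_ne_top.2 ⟨hE, ENNReal.ofReal_ne_top⟩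
    filter_upwards [h1.eventually_lt_const (ENNReal.lt_add_right hfin hpos)] with n hn
    refine hn.le.trans ?_
    gcongr
    exact hfE N
  obtain ⟨φ, hφ, hφd⟩ := exists_tendsto_atTop_diagonal hdiag
  refine ⟨fun n => (hfm (φ n)).toLp (f (φ n)), hconv.comp hφ, ?_⟩
  have hlimit : Tendsto (fun n => 2⁻¹ * (bondEnergy Ω R u + ENNReal.ofReal (1 / ((φ n : ℝ) + 1)))
      + ENNReal.ofReal (1 / ((φ n : ℝ) + 1))) atTop (𝓝 (2⁻¹ * bondEnergy Ω R u)) := by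
    have h := ((ENNReal.Tendsto.const_mul (a := 2⁻¹) (hzero.const_add (bondEnergy Ω R u))
      (.inr (by simp))).add hzero).comp hφ
    simpa [Function.comp_def] using h
  refine (limsup_le_limsup ?_).trans_eq hlimit.limsup_eq
  filter_upwards [hφd] with n hn
  rwa [storedEnergy_congr (hfm (φ n)).coeFn_toLp]

end Energies

theorem mainTheorem2 {d : ℕ} (hd : 1 ≤ d) (Ω : Set (EuclideanSpace ℝ (Fin d)))
    (hΩo : IsOpen Ω) (hΩb : Bornology.IsBounded Ω) (hΩl : HasLipschitzBoundary Ω)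
    (k : EuclideanSpace ℝ (Fin d) → ℝ) (Ψ : EuclideanSpace ℝ (Fin d) → ℝ → ℝ) (δ₀ : ℝ)
    (hw : IsMicroelasticPotential k Ψ δ₀)
    (hρ : LocallyIntegrable (linKernel k Ψ) volume)
    (l : L2Field Ω) :
    GammaConvergesZero
      (fun ε u => extNonlinearEnergy (fun ξ s => k ξ * Ψ ξ s) l ε u)
      (fun u => extLinearizedEnergy (linKernel k Ψ) l u) := by
  have : Nonempty (Fin d) := ⟨⟨0, hd⟩⟩
  have : Nontrivial (EuclideanSpace ℝ (Fin d)) := inferInstance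
  obtain ⟨W, R, C, hW, hRm, hC, hR0, hae, hle, hlim⟩ :=
    hw.exists_borel_representative hρ.aestronglyMeasurable.aemeasurable
  have hR : LocallyIntegrable R volume := hρ.congr (hae.mono fun ξ h => h.1)
  have hnl : ∀ ε u, extNonlinearEnergy (fun ξ s => k ξ * Ψ ξ s) l ε u
      = (storedEnergy Ω W ε u : EReal) - (loadWork l u : EReal) := fun ε u => by
    rw [extNonlinearEnergy_eq, nonlinearEnergy,
      lintegral_lintegral_eq_storedEnergy hW (hae.mono fun ξ h => h.2)]
  have hlin : ∀ u, extLinearizedEnergy (linKernel k Ψ) l u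
      = ((2⁻¹ * bondEnergy Ω R u : ℝ≥0∞) : EReal) - (loadWork l u : EReal) := fun u => by
    rw [extLinearizedEnergy_eq, linearizedEnergy,
      bondForm_eq_bondEnergy hRm (hae.mono fun ξ h => h.1)]
  intro ε hε0 hε u
  simp only [hnl, hlin]
  refine ⟨fun v hv => ?_, ?_⟩
  · exact coe_sub_le_liminf (bondEnergy_le_liminf_storedEnergy_of_tendsto hW hRm hlim hε0 hε hv)
      (tendsto_loadWork l hv)
  · obtain ⟨v, hv, hlimsup⟩ := exists_tendsto_limsup_storedEnergy_le hΩo hΩb hΩl hW hRm hR hR0 hC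
      hw.radius_pos hle hlim hε0 hε u
    exact ⟨v, hv, limsup_coe_sub_le hlimsup (tendsto_loadWork l hv)⟩
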